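/- Let $r\ge 0$, let $\underline a=(a_1,\dots,a_r)$ be integers $a_i\ge 2$, and let $n\ge 1$ be such that $\sum_{i=1}^r(a_i-1)=n-1$. Put $b_i=\sum_{j=1}^i(a_j-1)$. Let $c=(1,2,\dots,n)\in\mathfrak S_n$, and let $\mathcal M(\underline a)$ be the set of tuples $(z_1,\dots,z_r)$ in $\mathfrak S_n$ with $c=z_1\cdots z_r$ (products are composed from right to left) such that $z_i$ is a cycle of length $a_i$ for each $i$. A partition of a set $B\subseteq\{1,\dots,n\}$ is an *interval partition* if each of its blocks has the form $\{t\in B: x\le t\le y\}$ with $x,y\in B$; a *near interval partition* of $B$ is a partition obtained from an interval partition of $B$ with at least three blocks by merging its smallest and its largest block. A partition of $\{1,\dots,n\}$ is *noncrossing* if there are no $i<j<k<\ell$ with $i,k$ in one block and $j,\ell$ in another one. Let $\mathcal N(\underline a)$ be the set of tuples $(\pi_0,\dots,\pi_r)$ of noncrossing partitions of $\{1,\dots,n\}$ such that $\pi_0$ is the partition into singletons, $\pi_r$ is the partition with one block, and, for $1\le i\le r$, $\pi_{i-1}$ is obtained from $\pi_i$ by splitting one block $B$ of $\pi_i$ into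 $a_i$ blocks that form an interval partition or a near interval partition of $B$; write $\pi_{i-1}\sqsubset\pi_i$ if they form an interval partition of $B$. For a noncrossing partition $\pi$, let $\sigma_\pi$ be the permutation that maps each element of a block of $\pi$ to the next larger element of that block, and the largest element of the block to the smallest one. Then the map $(\pi_0,\dots,\pi_r)\mapsto(\sigma_{\pi_0}^{-1}\sigma_{\pi_1},\dots,\sigma_{\pi_{r-1}}^{-1}\sigma_{\pi_r})$ is a bijection from $\mathcal N(\underline a)$ to $\mathcal M(\underline a)$. If the weight of $(z_1,\dots,z_r)\in\mathcal M(\underline a)$ is defined, through the corresponding chain $(\pi_0,\dots,\pi_r)$, as the monomial $$\mathrm{wt}(z_1,\dots,z_r)=\prod_{\substack{1\le i\le r-1\\ \pi_i\not\sqsubset\pi_{i+1}}}X_i,$$ then, in $\mathbb Z[X_1,X_2,\dots]$, $$\sum_{(z_1,\dots,z_r)\in\mathcal M(\underline a)}\mathrm{wt}(z_1,\dots,z_r)=\prod_{i=1}^{r-1}\bigl(b_iX_i+n-b_i\bigr).$$ In particular (all $X_i=1$) the number of elements of $\mathcal M(\underline a)$ is $n^{r-1}$. -/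

import Mathlib

namespace MinFact

open Finset

/-- A partition of a subset `B` of the totally ordered set `Fin n` is noncrossing if there are no
`i < j < k < l` with `i, k` in one block and `j, l` in another one. -/
def IsNoncrossing {n : ℕ} {B : Finset (Fin n)} (P : Finpartition B) : Prop :=
  ∀ C ∈ P.parts, ∀ D ∈ P.parts, ∀ i ∈ C, ∀ j ∈ D, ∀ k ∈ C, ∀ l ∈ D,
    i < j → j < k → k < l → C = D

/-- A partition of `B` is an interval partition if each of its blocks is an interval
`{t ∈ B | a ≤ t ≤ b}` of the totally ordered set `B`, with `a, b ∈ B`. -/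
def IsIntervalPartition {n : ℕ} {B : Finset (Fin n)} (P : Finpartition B) : Prop :=
  ∀ C ∈ P.parts, ∃ a ∈ B, ∃ b ∈ B, C = B.filter (fun t => a ≤ t ∧ t ≤ b)

/-- A near interval partition of `B` is obtained from an interval partition of `B` with at least
three blocks by merging its smallest block `I` and its largest block `J`. -/
def IsNearIntervalPartition {n : ℕ} {B : Finset (Fin n)} (P : Finpartition B) : Prop :=
  ∃ Q : Finpartition B, IsIntervalPartition Q ∧ 3 ≤ Q.parts.card ∧
    ∃ I ∈ Q.parts, ∃ J ∈ Q.parts,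
      (∀ K ∈ Q.parts, K ≠ I → ∀ x ∈ I, ∀ y ∈ K, x < y) ∧
      (∀ K ∈ Q.parts, K ≠ J → ∀ x ∈ K, ∀ y ∈ J, x < y) ∧
      P.parts = insert (I ∪ J) ((Q.parts.erase I).erase J)

/-- `ρ` is obtained from `π` by replacing the block `B` of `π` by the blocks of the
partition `Q` of `B`. -/
def IsSplitting {n : ℕ} (ρ π : Finpartition (univ : Finset (Fin n))) (B : Finset (Fin n))
    (Q : Finpartition B) : Prop :=
  B ∈ π.parts ∧ ρ.parts = π.parts.erase B ∪ Q.parts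

/-- `ρ` is obtained from `π` by splitting a block `B` of `π` into `k` blocks which form an
interval partition or a near interval partition of `B`. -/
def SplitsInto {n : ℕ} (k : ℕ) (ρ π : Finpartition (univ : Finset (Fin n))) : Prop :=
  ∃ (B : Finset (Fin n)) (Q : Finpartition B), IsSplitting ρ π B Q ∧ Q.parts.card = k ∧
    (IsIntervalPartition Q ∨ IsNearIntervalPartition Q)

/-- The relation `ρ ⊏ π`: `ρ` is obtained from `π` by splitting a block `B` of `π` into blocks
which form an interval partition of `B`. -/
def IntervalSplit {n : ℕ} (ρ π : Finpartition (univ : Finset (Fin n))) : Prop :=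
  ∃ (B : Finset (Fin n)) (Q : Finpartition B), IsSplitting ρ π B Q ∧ IsIntervalPartition Q

/-- The set of chains `(π₀, …, π_r)` of noncrossing partitions of type `a`, from the partition
into singletons to the one-block partition. The entry `a i` is the `(i+1)`-st length. -/
def chains (n : ℕ) {r : ℕ} (a : Fin r → ℕ) :
    Set (Fin (r + 1) → Finpartition (univ : Finset (Fin n))) :=
  {p | (∀ i, IsNoncrossing (p i)) ∧ p 0 = ⊥ ∧ p (Fin.last r) = ⊤ ∧
    ∀ i : Fin r, SplitsInto (a i) (p i.castSucc) (p i.succ)}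

/-- The successor of `x` in its block, in the cyclic order: the next larger element of the block,
or the smallest element of the block if `x` is the largest one. -/
def nextInBlock {n : ℕ} (π : Finpartition (univ : Finset (Fin n))) (x : Fin n) : Fin n :=
  if h : ((π.part x).filter (fun y => x < y)).Nonempty then
    ((π.part x).filter (fun y => x < y)).min' h
  else (π.part x).min' ⟨x, π.mem_part (mem_univ x)⟩

theorem nextInBlock_mem {n : ℕ} (π : Finpartition (univ : Finset (Fin n))) (x : Fin n) :
    nextInBlock π x ∈ π.part x := by
  unfold nextInBlock
  split_ifs with h
  · exact (mem_filter.1 (min'_mem _ h)).1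
  · exact min'_mem _ _

theorem nextInBlock_cases {n : ℕ} (π : Finpartition (univ : Finset (Fin n))) (x : Fin n) :
    (x < nextInBlock π x ∧ ∀ y ∈ π.part x, x < y → nextInBlock π x ≤ y) ∨
    ((∀ y ∈ π.part x, y ≤ x) ∧ ∀ y ∈ π.part x, nextInBlock π x ≤ y) := by
  unfold nextInBlock
  split_ifs with h
  · exact Or.inl ⟨(mem_filter.1 (min'_mem _ h)).2,
      fun y hy hxy => min'_le _ _ (mem_filter.2 ⟨hy, hxy⟩)⟩
  · refine Or.inr ⟨fun y hy => ?_, fun y hy => min'_le _ _ hy⟩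
    by_contra hlt
    exact h ⟨y, mem_filter.2 ⟨hy, not_le.1 hlt⟩⟩

theorem nextInBlock_injective {n : ℕ} (π : Finpartition (univ : Finset (Fin n))) :
    Function.Injective (nextInBlock π) := by
  intro x y hxy
  have hpart : π.part x = π.part y := by
    have hx := nextInBlock_mem π x
    rw [hxy] at hx
    exact π.eq_of_mem_parts (π.part_mem.2 (mem_univ x)) (π.part_mem.2 (mem_univ y)) hx
      (nextInBlock_mem π y)
  have hx : x ∈ π.part x := π.mem_part (mem_univ x)
  have hy : y ∈ π.part x := hpart ▸ π.mem_part (mem_univ y)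
  have h1 := nextInBlock_cases π x
  have h2 := nextInBlock_cases π y
  rw [← hpart, ← hxy] at h2
  rcases h1 with ⟨h1, h1'⟩ | ⟨h1, h1'⟩ <;> rcases h2 with ⟨h2, h2'⟩ | ⟨h2, h2'⟩
  · rcases lt_trichotomy x y with h | h | h
    · exact absurd (h1' y hy h) (not_le.2 h2)
    · exact h
    · exact absurd (h2' x hx h) (not_le.2 h1)
  · exact absurd (h2' x hx) (not_le.2 h1)
  · exact absurd (h1' y hy) (not_le.2 h2)
  · exact le_antisymm (h2 x hx) (h1 y hy)

/-- The permutation `σ_π` whose orbits are the blocks of `π`, and which acts on each block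
`i₁ < ⋯ < i_m` as the cycle `i₁ ↦ i₂ ↦ ⋯ ↦ i_m ↦ i₁`. -/
noncomputable def blockPerm {n : ℕ} (π : Finpartition (univ : Finset (Fin n))) :
    Equiv.Perm (Fin n) :=
  Equiv.ofBijective (nextInBlock π) (Finite.injective_iff_bijective.1 (nextInBlock_injective π))

open Classical in
/-- The minimal factorizations `c = z₁ ⋯ z_r` of the long cycle `c` of `Fin n` of type `a`:
`z_i` is a cycle of length `a_i`. -/
noncomputable def factorizations (n : ℕ) {r : ℕ} (a : Fin r → ℕ) :
    Finset (Fin r → Equiv.Perm (Fin n)) :=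
  univ.filter fun z => (List.ofFn z).prod = finRotate n ∧
    ∀ i, (z i).IsCycle ∧ (z i).support.card = a i

/-- The tuple `(σ_{π₀}⁻¹ σ_{π₁}, …, σ_{π_{r-1}}⁻¹ σ_{π_r})` of a chain `(π₀, …, π_r)`. -/
noncomputable def chainToFactors {n r : ℕ}
    (p : Fin (r + 1) → Finpartition (univ : Finset (Fin n))) : Fin r → Equiv.Perm (Fin n) :=
  fun i => (blockPerm (p i.castSucc))⁻¹ * blockPerm (p i.succ)

open Classical in
/-- The weight of a chain `(π₀, …, π_r)`: the product of the variables `X_i`, `1 ≤ i ≤ r - 1`,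
such that `π_i ⊏ π_{i+1}` fails. -/
noncomputable def chainWeight {n r : ℕ}
    (p : Fin (r + 1) → Finpartition (univ : Finset (Fin n))) : MvPolynomial ℕ ℤ :=
  ∏ i ∈ univ.filter (fun i : Fin r => 1 ≤ i.val ∧ ¬ IntervalSplit (p i.castSucc) (p i.succ)),
    MvPolynomial.X i.val

/-- The weight of a factorization is the weight of the chain of type `a` that corresponds to it
under `chainToFactors`. -/
noncomputable def weight {n r : ℕ} (a : Fin r → ℕ) (z : Fin r → Equiv.Perm (Fin n)) :
    MvPolynomial ℕ ℤ :=
  chainWeight (Function.invFunOn chainToFactors (chains n a) z)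

/-- `b_i = ∑_{j ≤ i} (a_j - 1)`. The sum of the first `i` terms, as `a` is indexed from `0`. -/
def partialSum {r : ℕ} (a : Fin r → ℕ) (i : ℕ) : ℕ :=
  ∑ j ∈ univ.filter (fun j : Fin r => j.val < i), (a j - 1)

end MinFact

/-! Bijection. Cutting a block `B`, in its cyclic order, after each element of a subset `E` with `k
≥ 2` elements yields every interval or near interval partition of `B` into `k` blocks exactly once
(`splitsInto_iff`, `cut_injective`); it is an interval partition exactly when `E` contains the
largest element of `B`. If `ρ` is the result of such a cut of `π`, then `σ_ρ` times the increasing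
cycle on `E` is `σ_π` (`blockPerm_cut_mul_incCycle`), so chains give factorizations. Conversely,
removing the last factor, a cycle of length `a_i`, raises the number of cycles of a partial product
by at most `a_i - 1`. From `c` to the identity this number rises by `n - 1 = ∑ (a_i - 1)`, so every
step gains the maximum. This forces each factor to be an increasing cycle inside one block
(`exists_cut_of_fixedDim_maximal`), and the chain is rebuilt from the top down; noncrossing is
inherited by cuts.

Weighted count. Put `w_i = a_i - 1`, with `w(S)` the sum over `S`. The steps below `π` are
distributed over the blocks of `π`, so the weighted number of chains up to `π` is a product of block
weights under subset convolution (`sum_chainsTo`). A block of size `m` is supported on the step sets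
`S` with `w(S) = m - 1`, and its value there is `P_1(S)`, where `P_x(S) = x ∏ (x + w(S) + w(S_{<s})
(y_s - 1))` over the non-minimal `s ∈ S` (`hurwitz`). Let `K_x(S)` be the same product with `w(S)`
in place of the leading `x` (`weightedHurwitz`). In the induction the last step `i` cuts one block
into `w_i + 1` arcs. Cuts without wrap-around are compositions and contribute the power `P_1 ^ (w_i
+ 1)`. In the other cuts one arc consists of two pieces, which can be chosen in `w(T)` ways if its
step set is `T`; they contribute `y_i K_1 * P_{w_i}`. By the Abel–Hurwitz type identities `P_x * P_z
= P_{x+z}` and `K_x * P_z = K_{x+z}` (`hurwitz_mul`, `weightedHurwitz_mul`) the sum is `P_{1+w_i} +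
y_i K_{1+w_i}`, which is the recursion of `P_1` on adjoining a largest element
(`shift_blockWeight`). For the one-block partition, `P_1` at the set of all steps is the asserted
product. -/

namespace MinFact

open Finset

/-! ### The ring of set functions under subset convolution. -/

/-- Functions on finite sets of natural numbers, with the subset convolution as product. -/
def SetFun (R : Type*) : Type _ := Finset ℕ → R

namespace SetFun

variable {R : Type*}

/-- The shift of a set function by an index `i`. -/
def shift (i : ℕ) (f : SetFun R) : SetFun R := fun T => f (insert i T)

theorem shift_apply (i : ℕ) (f : SetFun R) (S : Finset ℕ) : shift i f S = f (insert i S) := rfl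

variable [CommRing R]

instance : AddCommGroup (SetFun R) := inferInstanceAs (AddCommGroup (Finset ℕ → R))

instance : Mul (SetFun R) := ⟨fun f g S => ∑ T ∈ S.powerset, f T * g (S \ T)⟩

instance : One (SetFun R) := ⟨fun S => if S = ∅ then 1 else 0⟩

theorem mul_apply (f g : SetFun R) (S : Finset ℕ) :
    (f * g) S = ∑ T ∈ S.powerset, f T * g (S \ T) := rfl

theorem one_apply (S : Finset ℕ) : (1 : SetFun R) S = if S = ∅ then 1 else 0 := rfl

theorem add_apply (f g : SetFun R) (S : Finset ℕ) : (f + g) S = f S + g S := rfl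

theorem zero_apply (S : Finset ℕ) : (0 : SetFun R) S = 0 := rfl

theorem conv_comm (f g : SetFun R) : f * g = g * f := by
  funext S
  rw [mul_apply, mul_apply]
  refine sum_bij' (fun T _ => S \ T) (fun T _ => S \ T) ?_ ?_ ?_ ?_ ?_
  · intro T _; simp
  · intro T _; simp
  · intro T hT; exact Finset.sdiff_sdiff_eq_self (mem_powerset.1 hT)
  · intro T hT; exact Finset.sdiff_sdiff_eq_self (mem_powerset.1 hT)
  · intro T hT
    simp only [Finset.sdiff_sdiff_eq_self (mem_powerset.1 hT), mul_comm]

theorem conv_assoc (f g h : SetFun R) : f * g * h = f * (g * h) := by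
  funext S
  simp only [mul_apply, sum_mul, mul_sum]
  rw [sum_sigma', sum_sigma']
  refine sum_bij' (fun p _ => ⟨p.2, p.1 \ p.2⟩) (fun p _ => ⟨p.1 ∪ p.2, p.1⟩) ?_ ?_ ?_ ?_ ?_
  · rintro ⟨T, U⟩ hp
    simp only [mem_sigma, mem_powerset] at hp ⊢
    exact ⟨hp.2.trans hp.1, sdiff_subset_sdiff hp.1 subset_rfl⟩
  · rintro ⟨U, V⟩ hp
    simp only [mem_sigma, mem_powerset] at hp ⊢
    exact ⟨union_subset hp.1 (hp.2.trans sdiff_subset), subset_union_left⟩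
  · rintro ⟨T, U⟩ hp
    simp only [mem_sigma, mem_powerset] at hp
    simp only [union_sdiff_of_subset hp.2]
  · rintro ⟨U, V⟩ hp
    simp only [mem_sigma, mem_powerset] at hp
    have : (U ∪ V) \ U = V := by
      ext t; have := @hp.2 t; simp only [mem_sdiff, mem_union] at this ⊢; tauto
    simp only [this]
  · rintro ⟨T, U⟩ hp
    simp only [mem_sigma, mem_powerset] at hp
    have : (S \ U) \ (T \ U) = S \ T := by
      ext t; have := @hp.2 t; simp only [mem_sdiff]; tauto
    simp only [this, mul_assoc]

theorem one_conv (f : SetFun R) : 1 * f = f := by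
  funext S
  rw [mul_apply, sum_eq_single ∅]
  · simp [one_apply]
  · intro T _ hT; simp [one_apply, hT]
  · simp

theorem conv_add (f g h : SetFun R) : f * (g + h) = f * g + f * h := by
  funext S
  simp only [mul_apply, add_apply, mul_add, sum_add_distrib]

theorem conv_zero (f : SetFun R) : f * 0 = 0 := by
  funext S
  simp only [mul_apply, zero_apply, mul_zero, sum_const_zero]

instance : CommRing (SetFun R) :=
  { (inferInstance : AddCommGroup (SetFun R)) with
    mul_assoc := conv_assoc
    mul_comm := conv_comm
    one_mul := one_conv
    mul_one := fun f => by rw [conv_comm, one_conv]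
    left_distrib := conv_add
    right_distrib := fun f g h => by rw [conv_comm, conv_add, conv_comm h, conv_comm h]
    zero_mul := fun f => by rw [conv_comm, conv_zero]
    mul_zero := conv_zero }

theorem sum_apply {ι : Type*} (s : Finset ι) (f : ι → SetFun R) (S : Finset ℕ) :
    (∑ i ∈ s, f i) S = ∑ i ∈ s, f i S := by
  classical
  induction s using Finset.induction_on with
  | empty => rfl
  | insert i s hi ih => rw [sum_insert hi, sum_insert hi, add_apply, ih]

/-- A product at `S` only involves values on subsets of `S`. This local form is needed because the
recursions used later hold only on sets lying below the adjoined index. -/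
theorem mul_apply_congr {f f' g g' : SetFun R} {S : Finset ℕ} (hf : ∀ T ⊆ S, f T = f' T)
    (hg : ∀ T ⊆ S, g T = g' T) : (f * g) S = (f' * g') S := by
  rw [mul_apply, mul_apply]
  exact sum_congr rfl fun T hT => by rw [hf T (mem_powerset.1 hT), hg _ sdiff_subset]

theorem mul_apply_linear {f g h : SetFun R} (k : SetFun R) {S : Finset ℕ} (a b : R)
    (hf : ∀ T ⊆ S, f T = a * g T + b * h T) :
    (f * k) S = a * (g * k) S + b * (h * k) S := by
  simp only [mul_apply, mul_sum, ← sum_add_distrib]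
  exact sum_congr rfl fun T hT => by rw [hf T (mem_powerset.1 hT)]; ring

/-- Leibniz rule: the new index goes either to the argument of `f` or to that of `g`, so `shift i`
acts as a derivation. -/
theorem mul_apply_insert (f g : SetFun R) {i : ℕ} {S : Finset ℕ} (hi : i ∉ S) :
    (f * g) (insert i S) = (shift i f * g) S + (f * shift i g) S := by
  rw [mul_apply, sum_powerset_insert hi, add_comm]
  congr 1
  · refine sum_congr rfl fun T hT => ?_
    rw [insert_sdiff_insert, sdiff_insert_of_notMem hi, shift]
  · refine sum_congr rfl fun T hT => ?_
    rw [insert_sdiff_of_notMem S fun h => hi (mem_powerset.1 hT h), shift]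

theorem prod_apply_insert {ι : Type*} [DecidableEq ι] (s : Finset ι) (f : ι → SetFun R) {i : ℕ}
    {S : Finset ℕ} (hi : i ∉ S) :
    (∏ b ∈ s, f b) (insert i S) = ∑ b ∈ s, (shift i (f b) * ∏ c ∈ s.erase b, f c) S := by
  induction s using Finset.induction_on generalizing S with
  | empty => simp [one_apply]
  | insert b s hb ih =>
    rw [prod_insert hb, mul_apply_insert _ _ hi, sum_insert hb, erase_insert hb]
    congr 1
    have : (f b * shift i (∏ c ∈ s, f c)) S
        = (f b * ∑ d ∈ s, shift i (f d) * ∏ c ∈ s.erase d, f c) S := by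
      refine mul_apply_congr (fun _ _ => rfl) fun T hT => ?_
      rw [shift, ih fun h => hi (hT h), sum_apply]
    rw [this, mul_sum, sum_apply]
    refine sum_congr rfl fun d hd => ?_
    have hbd : b ≠ d := fun h => hb (h ▸ hd)
    rw [erase_insert_of_ne hbd, prod_insert fun h => hb (mem_of_mem_erase h),
      mul_left_comm]

end SetFun

/-! ### Refined Hurwitz polynomials and their binomial identities. -/

section Hurwitz

variable {R : Type*} [CommRing R] (w : ℕ → ℕ) (y : ℕ → R)

/-- The product over the non-minimal elements `s` of `S` of the factors
`x + w(S) + w(S_{<s}) (y_s - 1)`. -/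
def reducedHurwitz (x : R) : SetFun R := fun S =>
  ∏ s ∈ S.filter (fun s => ∃ t ∈ S, t < s),
    (x + ((∑ t ∈ S, w t : ℕ) : R) + ((∑ t ∈ S.filter (· < s), w t : ℕ) : R) * (y s - 1))

/-- The refined Hurwitz polynomials, a family of set functions of binomial type. -/
def hurwitz (x : R) : SetFun R := fun S => if S = ∅ then 1 else x * reducedHurwitz w y x S

/-- The weighted version of `reducedHurwitz`. -/
def weightedHurwitz (x : R) : SetFun R := fun S =>
  ((∑ t ∈ S, w t : ℕ) : R) * reducedHurwitz w y x S

/-- Multiplication by the total weight of a set. -/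
def byWeight (f : SetFun R) : SetFun R := fun S => ((∑ t ∈ S, w t : ℕ) : R) * f S

theorem byWeight_apply (f : SetFun R) (S : Finset ℕ) :
    byWeight w f S = ((∑ t ∈ S, w t : ℕ) : R) * f S := rfl

theorem hurwitz_insert (x : R) (m : ℕ) (S : Finset ℕ) :
    hurwitz w y x (insert m S) = x * reducedHurwitz w y x (insert m S) :=
  if_neg (insert_ne_empty _ _)

theorem weightedHurwitz_apply (x : R) (S : Finset ℕ) :
    weightedHurwitz w y x S = ((∑ t ∈ S, w t : ℕ) : R) * reducedHurwitz w y x S := rfl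

theorem weight_mul_hurwitz (x : R) (S : Finset ℕ) :
    ((∑ t ∈ S, w t : ℕ) : R) * hurwitz w y x S = x * weightedHurwitz w y x S := by
  unfold hurwitz weightedHurwitz
  split_ifs with h
  · simp [h]
  · ring

/-- For `s ∈ S` the new weight `w m` is absorbed into `x`. If `S` is nonempty, `m` contributes the
factor `(x + w m) + w(S) * y m`, whose two terms give the two summands. -/
theorem reducedHurwitz_insert (x : R) {m : ℕ} {S : Finset ℕ} (hm : ∀ s ∈ S, s < m) :
    reducedHurwitz w y x (insert m S) =
      hurwitz w y (x + w m) S + y m * weightedHurwitz w y (x + w m) S := by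
  have hmS : m ∉ S := fun h => lt_irrefl _ (hm m h)
  rcases S.eq_empty_or_nonempty with rfl | hS
  · simp only [hurwitz, weightedHurwitz, reducedHurwitz, if_true]
    rw [filter_eq_empty_iff.2 (by simp)]
    simp
  · obtain ⟨t₀, ht₀⟩ := hS
    have h1 : (insert m S).filter (fun s => ∃ t ∈ insert m S, t < s) =
        insert m (S.filter (fun s => ∃ t ∈ S, t < s)) := by
      ext s
      simp only [mem_filter, mem_insert]
      constructor
      · rintro ⟨rfl | hs, t, rfl | ht, hts⟩
        · exact Or.inl rfl
        · exact Or.inl rfl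
        · exact absurd (hm s hs) (not_lt.2 hts.le)
        · exact Or.inr ⟨hs, t, ht, hts⟩
      · rintro (rfl | ⟨hs, t, ht, hts⟩)
        · exact ⟨Or.inl rfl, t₀, Or.inr ht₀, hm _ ht₀⟩
        · exact ⟨Or.inr hs, t, Or.inr ht, hts⟩
    have h2 : (insert m S).filter (· < m) = S := by
      ext s
      simp only [mem_filter, mem_insert]
      constructor
      · rintro ⟨rfl | hs, h⟩
        · exact absurd h (lt_irrefl _)
        · exact hs
      · exact fun hs => ⟨Or.inr hs, hm s hs⟩
    have h3 : ∏ s ∈ S.filter (fun s => ∃ t ∈ S, t < s),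
        (x + ((∑ t ∈ insert m S, w t : ℕ) : R) +
          ((∑ t ∈ (insert m S).filter (· < s), w t : ℕ) : R) * (y s - 1)) =
        reducedHurwitz w y (x + w m) S := by
      refine prod_congr rfl fun s hs => ?_
      have hs' := hm s (mem_filter.1 hs).1
      rw [filter_insert, if_neg (not_lt.2 hs'.le), sum_insert hmS]
      push_cast
      ring
    rw [reducedHurwitz, h1, prod_insert (fun h => hmS (mem_filter.1 h).1), h2, h3, hurwitz,
      if_neg (ne_empty_of_mem ht₀), weightedHurwitz, sum_insert hmS]
    push_cast
    ring

-- Joint induction, because the recursion of each family involves both. The Leibniz rule splits the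
-- value at `insert m S'`, and every resulting product is a convolution on `S'`.
open SetFun in
theorem hurwitz_mul_apply (S : Finset ℕ) : ∀ x z : R,
    (hurwitz w y x * hurwitz w y z) S = hurwitz w y (x + z) S ∧
    (weightedHurwitz w y x * hurwitz w y z) S = weightedHurwitz w y (x + z) S := by
  induction S using Finset.strongInduction with
  | H S ih =>
  rcases S.eq_empty_or_nonempty with rfl | hS
  · intro x z
    simp [mul_apply, hurwitz, weightedHurwitz]
  obtain ⟨m, S', hm, rfl⟩ : ∃ m S', (∀ s ∈ S', s < m) ∧ S = insert m S' :=
    ⟨S.max' hS, S.erase (S.max' hS), fun s hs => lt_max'_of_mem_erase_max' _ _ hs,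
      (insert_erase (max'_mem _ _)).symm⟩
  have hmS : m ∉ S' := fun h => lt_irrefl _ (hm m h)
  have ih' : ∀ T ⊆ S', ∀ x z : R,
      (hurwitz w y x * hurwitz w y z) T = hurwitz w y (x + z) T ∧
      (weightedHurwitz w y x * hurwitz w y z) T = weightedHurwitz w y (x + z) T :=
    fun T hT => ih T (Finset.ssubset_of_subset_of_ssubset hT (ssubset_insert hmS))
  have hP : ∀ x z : R, (hurwitz w y x * hurwitz w y z) S' = hurwitz w y (x + z) S' :=
    fun x z => (ih' S' subset_rfl x z).1
  have hK : ∀ x z : R, (weightedHurwitz w y x * hurwitz w y z) S' =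
      weightedHurwitz w y (x + z) S' :=
    fun x z => (ih' S' subset_rfl x z).2
  -- The convolution depends only on `x + z`, because `weightedHurwitz w y z` is the product of
  -- `weightedHurwitz w y 0` and `hurwitz w y z`.
  have hC : ∀ x z : R, (weightedHurwitz w y x * weightedHurwitz w y z) S' =
      (weightedHurwitz w y (x + z) * weightedHurwitz w y 0) S' := by
    intro x z
    have h1 : (weightedHurwitz w y x * weightedHurwitz w y z) S' =
        (weightedHurwitz w y x * (weightedHurwitz w y 0 * hurwitz w y z)) S' := by
      refine mul_apply_congr (fun _ _ => rfl) fun T hT => ?_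
      rw [(ih' T hT 0 z).2, zero_add]
    have h2 : (weightedHurwitz w y x * hurwitz w y z * weightedHurwitz w y 0) S' =
        (weightedHurwitz w y (x + z) * weightedHurwitz w y 0) S' :=
      mul_apply_congr (fun T hT => (ih' T hT x z).2) (fun _ _ => rfl)
    rw [h1, ← h2, mul_assoc, mul_comm (hurwitz w y z)]
  have hlt : ∀ T ⊆ S', ∀ s ∈ T, s < m := fun T hT s hs => hm s (hT hs)
  have shP : ∀ (x : R) (k : SetFun R), (shift m (hurwitz w y x) * k) S' =
      x * (hurwitz w y (x + w m) * k) S' +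
        x * y m * (weightedHurwitz w y (x + w m) * k) S' := by
    intro x k
    refine mul_apply_linear k _ _ fun T hT => ?_
    rw [shift_apply, hurwitz_insert, reducedHurwitz_insert w y x (hlt T hT)]
    ring
  have shK : ∀ (x : R) (k : SetFun R), (shift m (weightedHurwitz w y x) * k) S' =
      w m * (hurwitz w y (x + w m) * k) S' + (x + w m) * (weightedHurwitz w y (x + w m) * k) S' +
      y m * (w m * (weightedHurwitz w y (x + w m) * k) S' +
        (byWeight w (weightedHurwitz w y (x + w m)) * k) S') := by
    intro x k
    have e1 := mul_apply_linear (S := S') k (f := shift m (weightedHurwitz w y x))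
      (g := fun T => w m * hurwitz w y (x + w m) T + (x + w m) * weightedHurwitz w y (x + w m) T)
      (h := fun T => w m * weightedHurwitz w y (x + w m) T +
        1 * byWeight w (weightedHurwitz w y (x + w m)) T) 1 (y m) (fun T hT => by
          rw [shift_apply, weightedHurwitz_apply _ _ _ (insert m T),
            reducedHurwitz_insert w y x (hlt T hT), byWeight_apply,
            sum_insert fun h => hmS (hT h), ← weight_mul_hurwitz]
          push_cast
          ring)
    rw [e1, mul_apply_linear k _ _ fun T _ => rfl, mul_apply_linear k _ _ fun T _ => rfl]
    ring
  -- The weight of `T` is that of `S'` minus that of `S' \ T`, and the latter turns `hurwitz` into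
  -- `z * weightedHurwitz`.
  have hW : ∀ x z : R,
      (byWeight w (weightedHurwitz w y x) * hurwitz w y z) S' =
      ((∑ t ∈ S', w t : ℕ) : R) * weightedHurwitz w y (x + z) S' -
        z * (weightedHurwitz w y x * weightedHurwitz w y z) S' := by
    intro x z
    rw [← hK, mul_apply, mul_apply, mul_apply, mul_sum, mul_sum, ← sum_sub_distrib]
    refine sum_congr rfl fun T hT => ?_
    have := weight_mul_hurwitz w y z (S' \ T)
    rw [byWeight_apply, ← sum_sdiff (mem_powerset.1 hT)]
    push_cast at this ⊢
    linear_combination -weightedHurwitz w y x T * this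
  intro x z
  have e1 : x + w m + z = x + z + w m := by ring
  have e2 : z + w m + x = x + z + w m := by ring
  have e3 : x + (z + w m) = x + z + w m := by ring
  constructor
  · rw [mul_apply_insert _ _ hmS, shP, mul_comm (hurwitz w y x) (shift _ _), shP, hP, hK, hP, hK,
      hurwitz_insert, reducedHurwitz_insert w y _ hm, e1, e2]
    ring
  -- The two products of weighted functions, one from `hW` and one from `shP`, become equal up to
  -- sign by `hC` and cancel.
  · rw [mul_apply_insert _ _ hmS, shK, mul_comm (weightedHurwitz w y x) (shift _ _), shP, hP, hK,
      hW, mul_comm (hurwitz w y (z + w m)), hK, hC (x + w m) z, hC (z + w m) x,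
      weightedHurwitz_apply _ _ _ (insert m S'), reducedHurwitz_insert w y _ hm, sum_insert hmS,
      e1, e2, e3]
    have := weight_mul_hurwitz w y (x + z + w m) S'
    push_cast at this ⊢
    linear_combination -this

theorem hurwitz_mul (x z : R) : hurwitz w y x * hurwitz w y z = hurwitz w y (x + z) :=
  funext fun S => (hurwitz_mul_apply w y S x z).1

theorem weightedHurwitz_mul (x z : R) :
    weightedHurwitz w y x * hurwitz w y z = weightedHurwitz w y (x + z) :=
  funext fun S => (hurwitz_mul_apply w y S x z).2

theorem hurwitz_zero : hurwitz w y 0 = 1 := by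
  funext S
  rw [hurwitz, SetFun.one_apply]
  simp

end Hurwitz

end MinFact
namespace MinFact

open Finset

/-! ### Cutting a finite ordered set cyclically. -/

section Label

variable {α : Type*} [LinearOrder α]

/-- The first element of `E` which is at least `x`, in the cyclic order: if all elements of `E`
are smaller than `x`, it is the smallest element of `E`. -/
def label (E : Finset α) (x : α) : α :=
  if h : (E.filter (x ≤ ·)).Nonempty then (E.filter (x ≤ ·)).min' h
  else if h : E.Nonempty then E.min' h else x

theorem label_spec {E : Finset α} (hE : E.Nonempty) (x : α) :
    label E x ∈ E ∧ ((x ≤ label E x ∧ ∀ e ∈ E, x ≤ e → label E x ≤ e) ∨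
      ((∀ e ∈ E, e < x) ∧ ∀ e ∈ E, label E x ≤ e)) := by
  unfold label
  split_ifs with h
  · have := mem_filter.1 (min'_mem _ h)
    exact ⟨this.1, Or.inl ⟨this.2, fun e he hxe => min'_le _ _ (mem_filter.2 ⟨he, hxe⟩)⟩⟩
  · refine ⟨min'_mem _ _, Or.inr ⟨fun e he => ?_, fun e he => min'_le _ _ he⟩⟩
    by_contra hlt
    exact h ⟨e, mem_filter.2 ⟨he, not_lt.1 hlt⟩⟩

theorem label_eq {E : Finset α} {x e : α} (he : e ∈ E)
    (h : (x ≤ e ∧ ∀ e' ∈ E, x ≤ e' → e ≤ e') ∨ ((∀ e' ∈ E, e' < x) ∧ ∀ e' ∈ E, e ≤ e')) :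
    label E x = e := by
  obtain ⟨h1, h2⟩ := label_spec ⟨e, he⟩ x
  rcases h with ⟨h, h'⟩ | ⟨h, h'⟩ <;> rcases h2 with ⟨h2, h2'⟩ | ⟨h2, h2'⟩
  · exact le_antisymm (h2' e he h) (h' _ h1 h2)
  · exact absurd (h2 e he) (not_lt.2 h)
  · exact absurd (h _ h1) (not_lt.2 h2)
  · exact le_antisymm (h2' e he) (h' _ h1)

theorem label_eq_iff {E : Finset α} {x e : α} (he : e ∈ E) : label E x = e ↔
    (x ≤ e ∧ ∀ e' ∈ E, x ≤ e' → e ≤ e') ∨ ((∀ e' ∈ E, e' < x) ∧ ∀ e' ∈ E, e ≤ e') :=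
  ⟨fun h => h ▸ (label_spec ⟨e, he⟩ x).2, label_eq he⟩

theorem label_self {E : Finset α} {e : α} (he : e ∈ E) : label E e = e :=
  label_eq he (Or.inl ⟨le_rfl, fun _ _ h => h⟩)

/-- The cyclic interval of `B` which ends in `e`, if `B` is cut after each element of `E`. -/
def arc (B E : Finset α) (e : α) : Finset α := B.filter (fun x => label E x = e)

theorem mem_arc {B E : Finset α} {e x : α} : x ∈ arc B E e ↔ x ∈ B ∧ label E x = e := mem_filter

/-- The part of `arc B E e` below `e`. -/
def lowerArc (B E : Finset α) (e : α) : Finset α :=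
  B.filter (fun x => x ≤ e ∧ ∀ e' ∈ E, x ≤ e' → e ≤ e')

theorem mem_lowerArc {B E : Finset α} {e x : α} :
    x ∈ lowerArc B E e ↔ x ∈ B ∧ x ≤ e ∧ ∀ e' ∈ E, x ≤ e' → e ≤ e' := mem_filter

/-- `E` contains an upper bound of each element of `B`. -/
def Dominates (E B : Finset α) : Prop := ∀ x ∈ B, ∃ e ∈ E, x ≤ e

/-- Only the arc of the smallest cut point can wrap around, and it then gains the elements above all
cut points. -/
theorem card_arc {B E : Finset α} {e : α} (he : e ∈ E) :
    (arc B E e).card = (lowerArc B E e).card +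
      if ∀ e' ∈ E, e ≤ e' then (B.filter (fun x => ∀ e' ∈ E, e' < x)).card else 0 := by
  have hd : Disjoint (lowerArc B E e)
      (if ∀ e' ∈ E, e ≤ e' then B.filter (fun x => ∀ e' ∈ E, e' < x) else ∅) := by
    rw [disjoint_left]
    intro x hx hx'
    split_ifs at hx' with h
    · exact absurd ((mem_filter.1 hx').2 e he) (not_lt.2 (mem_lowerArc.1 hx).2.1)
    · exact absurd hx' (notMem_empty x)
  have : arc B E e = lowerArc B E e ∪
      (if ∀ e' ∈ E, e ≤ e' then B.filter (fun x => ∀ e' ∈ E, e' < x) else ∅) := by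
    ext x
    rw [mem_arc, label_eq_iff he, mem_union, mem_lowerArc]
    split_ifs with h
    · rw [mem_filter]; tauto
    · simp only [notMem_empty]; tauto
  rw [this, card_union_of_disjoint hd]
  split_ifs <;> simp

/-- The number of elements of `B` up to `e` is the rank of `e`, and the ranks run through `1, …,
B.card`. -/
theorem sum_card_filter_le {M : Type*} [AddCommMonoid M] (B : Finset α) (φ : ℕ → M) :
    ∑ e ∈ B, φ (B.filter (· ≤ e)).card = ∑ i ∈ range B.card, φ (i + 1) := by
  induction B using Finset.induction_on_max with
  | empty => simp
  | insert a s ha ih =>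
    have has : a ∉ s := fun h => lt_irrefl _ (ha a h)
    have h1 : (insert a s).filter (· ≤ a) = insert a s :=
      filter_true_of_mem fun x hx => by
        rcases mem_insert.1 hx with rfl | hx
        · exact le_rfl
        · exact (ha x hx).le
    have h2 : ∑ e ∈ s, φ ((insert a s).filter (· ≤ e)).card =
        ∑ e ∈ s, φ (s.filter (· ≤ e)).card := by
      refine sum_congr rfl fun e he => ?_
      rw [filter_insert, if_neg (not_le.2 (ha e he))]
    rw [sum_insert has, h1, h2, ih, card_insert_of_notMem has, sum_range_succ, add_comm]

theorem sum_powersetCard_succ_min {M : Type*} [AddCommMonoid M] (B : Finset α) (k : ℕ)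
    (F : Finset α → M) :
    ∑ E ∈ B.powersetCard (k + 1), F E =
      ∑ e ∈ B, ∑ E ∈ (B.filter (e < ·)).powersetCard k, F (insert e E) := by
  rw [sum_sigma']
  symm
  refine sum_bij (fun p _ => insert p.1 p.2) ?_ ?_ ?_ (fun _ _ => rfl)
  · rintro ⟨e, E⟩ hp
    simp only [mem_sigma, mem_powersetCard] at hp ⊢
    obtain ⟨he, hE, hk⟩ := hp
    refine ⟨insert_subset he (hE.trans (filter_subset _ _)), ?_⟩
    rw [card_insert_of_notMem fun h => lt_irrefl _ (mem_filter.1 (hE h)).2, hk]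
  · rintro ⟨e, E⟩ hp ⟨e', E'⟩ hp' h
    simp only [mem_sigma, mem_powersetCard] at hp hp' h
    have key : ∀ {e e' : α} {E E' : Finset α}, E' ⊆ B.filter (e' < ·) → insert e E = insert e' E' →
        e' ≤ e := by
      intro e e' E E' hE' h
      rcases mem_insert.1 (h ▸ mem_insert_self e E) with h | h
      · exact h.ge
      · exact (mem_filter.1 (hE' h)).2.le
    obtain rfl : e = e' := le_antisymm (key hp.2.1 h.symm) (key hp'.2.1 h)
    have h1 : e ∉ E := fun h => lt_irrefl _ (mem_filter.1 (hp.2.1 h)).2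
    have h2 : e ∉ E' := fun h => lt_irrefl _ (mem_filter.1 (hp'.2.1 h)).2
    rw [← erase_insert h1, ← erase_insert h2, h]
  · intro E hE
    rw [mem_powersetCard] at hE
    have hne : E.Nonempty := card_pos.1 (by omega)
    refine ⟨⟨E.min' hne, E.erase (E.min' hne)⟩, ?_, insert_erase (min'_mem _ hne)⟩
    simp only [mem_sigma, mem_powersetCard]
    refine ⟨hE.1 (min'_mem _ _), fun x hx => ?_, ?_⟩
    · exact mem_filter.2 ⟨hE.1 (mem_of_mem_erase hx), min'_lt_of_mem_erase_min' _ _ hx⟩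
    · rw [card_erase_of_mem (min'_mem _ _), hE.2]; rfl

-- Here `x` is the largest element of `E`: a subset of the elements up to `x` dominates them exactly
-- when it contains `x`.
open Classical in
theorem sum_powersetCard_succ_max {M : Type*} [AddCommMonoid M] (B : Finset α) (k : ℕ)
    (F : Finset α → M) :
    ∑ E ∈ B.powersetCard (k + 1), F E =
      ∑ x ∈ B, ∑ E ∈ ((B.filter (· ≤ x)).powersetCard (k + 1)).filter
        (Dominates · (B.filter (· ≤ x))), F E := by
  rw [sum_sigma']
  symm
  have hmem : ∀ {x : α} {E : Finset α}, x ∈ B → E ⊆ B.filter (· ≤ x) →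
      Dominates E (B.filter (· ≤ x)) → x ∈ E ∧ ∀ e ∈ E, e ≤ x := by
    intro x E hx hE hd
    obtain ⟨e, he, hxe⟩ := hd x (mem_filter.2 ⟨hx, le_rfl⟩)
    exact ⟨le_antisymm hxe (mem_filter.1 (hE he)).2 ▸ he, fun e he => (mem_filter.1 (hE he)).2⟩
  refine sum_bij (fun p _ => p.2) ?_ ?_ ?_ (fun _ _ => rfl)
  · rintro ⟨x, E⟩ hp
    simp only [mem_sigma, mem_filter, mem_powersetCard] at hp ⊢
    exact ⟨hp.2.1.1.trans (filter_subset _ _), hp.2.1.2⟩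
  · rintro ⟨x, E⟩ hp ⟨x', E'⟩ hp' h
    simp only [mem_sigma, mem_filter, mem_powersetCard] at hp hp' h
    subst h
    have h1 := hmem hp.1 hp.2.1.1 hp.2.2
    have h2 := hmem hp'.1 hp'.2.1.1 hp'.2.2
    obtain rfl : x = x' := le_antisymm (h2.2 x h1.1) (h1.2 x' h2.1)
    rfl
  · intro E hE
    rw [mem_powersetCard] at hE
    have hne : E.Nonempty := card_pos.1 (by omega)
    refine ⟨⟨E.max' hne, E⟩, ?_, rfl⟩
    simp only [mem_sigma, mem_filter, mem_powersetCard]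
    exact ⟨hE.1 (max'_mem _ _), ⟨fun x hx => mem_filter.2 ⟨hE.1 hx, le_max' _ _ hx⟩, hE.2⟩,
      fun x hx => ⟨_, max'_mem _ _, (mem_filter.1 hx).2⟩⟩

end Label

/-! ### Cut sets and compositions. -/

section CompositionSum

variable {A : Type*} [CommRing A] (g : ℕ → A)

/-- The sum over the compositions of `m` into `k` positive parts of the products of the values
of `g` at the parts. -/
def compositionSum : ℕ → ℕ → A
  | 0, m => if m = 0 then 1 else 0
  | k + 1, m => ∑ i ∈ range m, g (i + 1) * compositionSum k (m - (i + 1))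

variable {α : Type*} [LinearOrder α]

theorem lowerArc_insert_self {B E : Finset α} {e : α} (hE : ∀ x ∈ E, e < x) :
    lowerArc B (insert e E) e = B.filter (· ≤ e) := by
  ext x
  rw [mem_lowerArc, mem_filter]
  refine ⟨fun h => ⟨h.1, h.2.1⟩, fun h => ⟨h.1, h.2, fun e' he' _ => ?_⟩⟩
  rcases mem_insert.1 he' with rfl | h'
  · exact le_rfl
  · exact (hE _ h').le

theorem lowerArc_insert_of_mem {B E : Finset α} {e e' : α} (hE : ∀ x ∈ E, e < x) (he' : e' ∈ E) :
    lowerArc B (insert e E) e' = lowerArc (B.filter (e < ·)) E e' := by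
  ext x
  rw [mem_lowerArc, mem_lowerArc, mem_filter]
  constructor
  · rintro ⟨h1, h2, h3⟩
    refine ⟨⟨h1, ?_⟩, h2, fun e'' h => h3 e'' (mem_insert_of_mem h)⟩
    by_contra hx
    exact absurd (h3 e (mem_insert_self _ _) (not_lt.1 hx)) (not_le.2 (hE e' he'))
  · rintro ⟨⟨h1, h1'⟩, h2, h3⟩
    refine ⟨h1, h2, fun e'' h hx => ?_⟩
    rcases mem_insert.1 h with rfl | h
    · exact absurd h1' (not_lt.2 hx)
    · exact h3 e'' h hx

theorem dominates_insert {B E : Finset α} {e : α} :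
    Dominates (insert e E) B ↔ Dominates E (B.filter (e < ·)) := by
  constructor
  · intro h x hx
    obtain ⟨e', he', hxe'⟩ := h x (mem_filter.1 hx).1
    rcases mem_insert.1 he' with rfl | he'
    · exact absurd (mem_filter.1 hx).2 (not_lt.2 hxe')
    · exact ⟨e', he', hxe'⟩
  · intro h x hx
    by_cases hxe : x ≤ e
    · exact ⟨e, mem_insert_self _ _, hxe⟩
    · obtain ⟨e', he', hxe'⟩ := h x (mem_filter.2 ⟨hx, not_le.1 hxe⟩)
      exact ⟨e', mem_insert_of_mem he', hxe'⟩

theorem card_filter_lt (B : Finset α) (e : α) :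
    (B.filter (e < ·)).card = B.card - (B.filter (· ≤ e)).card := by
  have := card_filter_add_card_filter_not (s := B) (· ≤ e)
  simp only [not_le] at this
  omega

-- A dominating cut set is the same as the composition formed by the sizes of its arcs; splitting
-- off the smallest cut point is splitting off the first part.
open Classical in
theorem sum_dominates_eq_compositionSum (k : ℕ) (B : Finset α) :
    ∑ E ∈ (B.powersetCard k).filter (Dominates · B), ∏ e ∈ E, g (lowerArc B E e).card =
      compositionSum g k B.card := by
  induction k generalizing B with
  | zero =>
    rw [powersetCard_zero, filter_singleton, compositionSum]
    rcases B.eq_empty_or_nonempty with rfl | ⟨x, hx⟩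
    · rw [if_pos (by simp [Dominates])]; simp
    · rw [if_neg (fun h => by obtain ⟨e, he, _⟩ := h x hx; exact notMem_empty _ he),
        if_neg (card_ne_zero_of_mem hx), sum_empty]
  | succ k ih =>
    rw [sum_filter, sum_powersetCard_succ_min, compositionSum,
      ← sum_card_filter_le B (fun i => g i * compositionSum g k (B.card - i))]
    refine sum_congr rfl fun e he => ?_
    rw [← card_filter_lt, ← ih, sum_filter, mul_sum]
    refine sum_congr rfl fun E hE => ?_
    have hE' : ∀ x ∈ E, e < x := fun x hx => (mem_filter.1 ((mem_powersetCard.1 hE).1 hx)).2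
    rw [if_congr dominates_insert rfl rfl, prod_insert fun h => lt_irrefl _ (hE' e h),
      lowerArc_insert_self hE', mul_ite, mul_zero,
      prod_congr rfl fun e' he' => by rw [lowerArc_insert_of_mem hE' he']]

-- The arc of the smallest cut point is enlarged by `j`, the number of elements that will wrap
-- around to it.
open Classical in
theorem sum_dominates_shift (k j : ℕ) (B : Finset α) :
    ∑ E ∈ (B.powersetCard (k + 1)).filter (Dominates · B),
      ∏ e ∈ E, g ((lowerArc B E e).card + if ∀ e' ∈ E, e ≤ e' then j else 0) =
      ∑ i ∈ range B.card, g (i + 1 + j) * compositionSum g k (B.card - (i + 1)) := by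
  rw [sum_filter, sum_powersetCard_succ_min,
    ← sum_card_filter_le B (fun i => g (i + j) * compositionSum g k (B.card - i))]
  refine sum_congr rfl fun e he => ?_
  rw [← card_filter_lt, ← sum_dominates_eq_compositionSum, sum_filter, mul_sum]
  refine sum_congr rfl fun E hE => ?_
  have hE' : ∀ x ∈ E, e < x := fun x hx => (mem_filter.1 ((mem_powersetCard.1 hE).1 hx)).2
  have h1 : ∀ e' ∈ insert e E, e ≤ e' := fun e' he' => by
    rcases mem_insert.1 he' with rfl | h'
    · exact le_rfl
    · exact (hE' _ h').le
  rw [if_congr dominates_insert rfl rfl, prod_insert fun h => lt_irrefl _ (hE' e h),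
    lowerArc_insert_self hE', mul_ite, mul_zero, if_pos h1]
  congr 2
  refine prod_congr rfl fun e' he' => ?_
  rw [lowerArc_insert_of_mem hE' he',
    if_neg fun h => absurd (h e (mem_insert_self _ _)) (not_le.2 (hE' e' he')), add_zero]

open Classical in
theorem sum_arc_dominates (k : ℕ) (B : Finset α) :
    ∑ E ∈ (B.powersetCard k).filter (Dominates · B), ∏ e ∈ E, g (arc B E e).card =
      compositionSum g k B.card := by
  rw [← sum_dominates_eq_compositionSum]
  refine sum_congr rfl fun E hE => prod_congr rfl fun e he => ?_
  have : B.filter (fun x => ∀ e' ∈ E, e' < x) = ∅ :=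
    filter_eq_empty_iff.2 fun x hx h => by
      obtain ⟨e', he', hx'⟩ := (mem_filter.1 hE).2 x hx
      exact absurd (h e' he') (not_lt.2 hx')
  rw [card_arc he, this, card_empty, ite_self, add_zero]

-- With `x` the largest cut point, `q + 1` is the rank of `x`, the remaining `B.card - (q + 1)`
-- elements wrap around, and `i + 1` is the size of the part of the first arc below its end.
open Classical in
theorem sum_arc_not_dominates (k : ℕ) (B : Finset α) :
    ∑ E ∈ (B.powersetCard (k + 1)).filter (¬ Dominates · B), ∏ e ∈ E, g (arc B E e).card =
      ∑ q ∈ range (B.card - 1), ∑ i ∈ range (q + 1),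
        g (i + 1 + (B.card - (q + 1))) * compositionSum g k (q + 1 - (i + 1)) := by
  rcases B.eq_empty_or_nonempty with rfl | hB
  · rw [powersetCard_eq_empty.2 (by simp)]
    simp
  rw [sum_filter, sum_powersetCard_succ_max]
  have key : ∀ x ∈ B, ∑ E ∈ ((B.filter (· ≤ x)).powersetCard (k + 1)).filter
        (Dominates · (B.filter (· ≤ x))),
        (if ¬ Dominates E B then ∏ e ∈ E, g (arc B E e).card else 0) =
      (fun p => if p < B.card then ∑ i ∈ range p,
        g (i + 1 + (B.card - p)) * compositionSum g k (p - (i + 1)) else 0)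
          (B.filter (· ≤ x)).card := by
    intro x hx
    have hxE : ∀ E ∈ ((B.filter (· ≤ x)).powersetCard (k + 1)).filter
        (Dominates · (B.filter (· ≤ x))), x ∈ E ∧ ∀ e ∈ E, e ≤ x := by
      intro E hE
      obtain ⟨hE, hd⟩ := mem_filter.1 hE
      have hE := (mem_powersetCard.1 hE).1
      obtain ⟨e, he, hxe⟩ := hd x (mem_filter.2 ⟨hx, le_rfl⟩)
      exact ⟨le_antisymm hxe (mem_filter.1 (hE he)).2 ▸ he, fun e he => (mem_filter.1 (hE he)).2⟩
    -- If `x` is also the largest element of `B`, then `E` dominates `B` and nothing is counted;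
    -- hence `q` stays below `B.card - 1`.
    by_cases hmax : ∀ t ∈ B, t ≤ x
    · have h1 : (B.filter (· ≤ x)) = B := filter_true_of_mem hmax
      simp only [h1, lt_irrefl, if_false]
      exact sum_eq_zero fun E hE => by rw [if_neg (not_not.2 (mem_filter.1 hE).2)]
    · have h1 : (B.filter (· ≤ x)).card < B.card :=
        card_lt_card (filter_ssubset.2 (by simpa using hmax))
      simp only [h1, if_true]
      rw [← sum_dominates_shift]
      refine sum_congr rfl fun E hE => ?_
      obtain ⟨hxE, hEx⟩ := hxE E hE
      have h2 : ¬ Dominates E B := fun h => hmax fun t ht => by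
        obtain ⟨e, he, hte⟩ := h t ht
        exact hte.trans (hEx e he)
      have h3 : B.filter (fun t => ∀ e' ∈ E, e' < t) = B.filter (x < ·) :=
        filter_congr fun t _ => ⟨fun h => h x hxE, fun h e' he' => (hEx e' he').trans_lt h⟩
      rw [if_pos h2]
      refine prod_congr rfl fun e he => ?_
      have h4 : lowerArc B E e = lowerArc (B.filter (· ≤ x)) E e := by
        ext t
        rw [mem_lowerArc, mem_lowerArc, mem_filter]
        exact ⟨fun h => ⟨⟨h.1, h.2.1.trans (hEx e he)⟩, h.2⟩, fun h => ⟨h.1.1, h.2⟩⟩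
      rw [card_arc he, h3, card_filter_lt, h4]
  refine (sum_congr rfl key).trans ((sum_card_filter_le B (fun p => if p < B.card then
    ∑ i ∈ range p, g (i + 1 + (B.card - p)) * compositionSum g k (p - (i + 1)) else 0)).trans ?_)
  obtain ⟨m, hm⟩ : ∃ m, B.card = m + 1 := ⟨B.card - 1, by have := hB.card_pos; omega⟩
  rw [hm, sum_range_succ, if_neg (lt_irrefl _), add_zero]
  refine sum_congr rfl fun q hq => ?_
  rw [if_pos (by have := mem_range.1 hq; omega)]

end CompositionSum

/-! ### The weight of a block and its recursion under cutting. -/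

section BlockWeight

variable {R : Type*} [CommRing R] (w : ℕ → ℕ) (y : ℕ → R)

/-- The weight of a block of size `m`: the set function that is equal to `hurwitz w y 1` on the
sets of total weight `m - 1`, and zero otherwise. -/
def blockWeight (m : ℕ) : SetFun R := fun S =>
  if ∑ t ∈ S, w t + 1 = m then hurwitz w y 1 S else 0

theorem blockWeight_apply (m : ℕ) (S : Finset ℕ) :
    blockWeight w y m S = if ∑ t ∈ S, w t + 1 = m then hurwitz w y 1 S else 0 := rfl

/-- The size of each part is determined by the weight of its step set, so the sum is the `k`-th
convolution power of `hurwitz w y 1`, restricted to the right total weight. -/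
theorem compositionSum_blockWeight (k m : ℕ) (S : Finset ℕ) :
    compositionSum (blockWeight w y) k m S =
      if ∑ t ∈ S, w t + k = m then hurwitz w y k S else 0 := by
  induction k generalizing m S with
  | zero =>
    rw [compositionSum, Nat.cast_zero, hurwitz_zero]
    rcases S.eq_empty_or_nonempty with rfl | hS
    · by_cases hm : m = 0
      · simp [hm]
      · rw [if_neg hm, if_neg (by simpa using Ne.symm hm)]; rfl
    · have : (1 : SetFun R) S = 0 := by rw [SetFun.one_apply, if_neg hS.ne_empty]
      split_ifs <;> simp [this, SetFun.zero_apply]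
  | succ k ih =>
    have h1 : ((k + 1 : ℕ) : R) = 1 + k := by push_cast; ring
    rw [compositionSum, SetFun.sum_apply, h1, ← hurwitz_mul]
    simp only [SetFun.mul_apply, ih, blockWeight_apply]
    rw [sum_comm]
    by_cases hS : ∑ t ∈ S, w t + (k + 1) = m
    · rw [if_pos hS]
      refine sum_congr rfl fun T hT => ?_
      have := sum_sdiff (f := w) (mem_powerset.1 hT)
      rw [sum_eq_single (∑ t ∈ T, w t), if_pos rfl, if_pos (by omega)]
      · intro b _ hb
        rw [if_neg (by omega), zero_mul]
      · intro h
        exact absurd (mem_range.2 (by omega)) h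
    · rw [if_neg hS]
      refine sum_eq_zero fun T hT => sum_eq_zero fun i hi => ?_
      have := sum_sdiff (f := w) (mem_powerset.1 hT)
      have := mem_range.1 hi
      by_cases h : ∑ t ∈ T, w t + 1 = i + 1
      · rw [if_neg (show ¬ (∑ t ∈ S \ T, w t + k = m - (i + 1)) by omega), mul_zero]
      · rw [if_neg h, zero_mul]

/-- A first block with step set `T` has `∑ t ∈ T, w t + 1` elements, hence `∑ t ∈ T, w t` divisions
into a lower and a wrapped piece, both nonempty. This multiplicity turns `hurwitz w y 1` into
`weightedHurwitz w y 1`. -/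
theorem sum_shifted_compositionSum_blockWeight (k m : ℕ) (S : Finset ℕ) :
    (∑ q ∈ range (m - 1), ∑ i ∈ range (q + 1), blockWeight w y (i + 1 + (m - (q + 1))) *
      compositionSum (blockWeight w y) k (q + 1 - (i + 1)) : SetFun R) S =
      if ∑ t ∈ S, w t + (k + 1) = m then weightedHurwitz w y (1 + k) S else 0 := by
  -- The conditions force `i = q - u` and `t + u + 1 = m`, and then `q` runs through the `t` values
  -- from `u` to `m - 2`.
  have count : ∀ (t u : ℕ) (c : R), ∑ q ∈ range (m - 1), ∑ i ∈ range (q + 1),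
      (if t + 1 = i + 1 + (m - (q + 1)) ∧ u = q + 1 - (i + 1) then c else 0) =
        if t + u + 1 = m then (t : R) * c else 0 := by
    intro t u c
    have inner : ∀ q ∈ range (m - 1), ∑ i ∈ range (q + 1),
        (if t + 1 = i + 1 + (m - (q + 1)) ∧ u = q + 1 - (i + 1) then c else 0) =
        if t + u + 1 = m ∧ u ≤ q then c else 0 := by
      intro q hq
      have hq := mem_range.1 hq
      by_cases h : t + u + 1 = m ∧ u ≤ q
      · rw [if_pos h, sum_eq_single (q - u), if_pos (by omega)]
        · intro i hi hne
          have := mem_range.1 hi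
          rw [if_neg (by omega)]
        · intro hi
          exact absurd (mem_range.2 (by omega)) hi
      · rw [if_neg h]
        refine sum_eq_zero fun i hi => ?_
        have := mem_range.1 hi
        rw [if_neg (by omega)]
    rw [sum_congr rfl inner]
    by_cases h : t + u + 1 = m
    · have : (range (m - 1)).filter (fun q => u ≤ q) = Ico u (m - 1) := by
        ext q; simp only [mem_filter, mem_range, mem_Ico]; omega
      simp only [h, true_and, if_true]
      rw [← sum_filter, this, sum_const, Nat.card_Ico, nsmul_eq_mul]
      congr 2
      omega
    · simp [h]
  rw [SetFun.sum_apply]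
  simp only [SetFun.sum_apply]
  rw [← weightedHurwitz_mul]
  simp only [SetFun.mul_apply, compositionSum_blockWeight, blockWeight_apply]
  have : ∀ q ∈ range (m - 1), ∑ i ∈ range (q + 1), ∑ T ∈ S.powerset,
      (if ∑ t ∈ T, w t + 1 = i + 1 + (m - (q + 1)) then hurwitz w y 1 T else 0) *
        (if ∑ t ∈ S \ T, w t + k = q + 1 - (i + 1) then hurwitz w y k (S \ T) else 0) =
      ∑ T ∈ S.powerset, ∑ i ∈ range (q + 1),
      (if ∑ t ∈ T, w t + 1 = i + 1 + (m - (q + 1)) ∧ ∑ t ∈ S \ T, w t + k = q + 1 - (i + 1)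
        then hurwitz w y 1 T * hurwitz w y k (S \ T) else 0) := by
    intro q _
    rw [sum_comm]
    refine sum_congr rfl fun T _ => sum_congr rfl fun i _ => ?_
    rw [ite_zero_mul_ite_zero]
  rw [sum_congr rfl this, sum_comm]
  simp only [count]
  rw [← sum_filter_add_sum_filter_not S.powerset (fun _ => ∑ t ∈ S, w t + (k + 1) = m)]
  by_cases hS : ∑ t ∈ S, w t + (k + 1) = m
  · simp only [hS, not_true_eq_false, filter_true, filter_false, sum_empty, add_zero, if_true]
    refine sum_congr rfl fun T hT => ?_
    have := sum_sdiff (f := w) (mem_powerset.1 hT)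
    rw [if_pos (by omega), ← mul_assoc, weight_mul_hurwitz, one_mul]
  · simp only [hS, not_false_eq_true, filter_true, filter_false, sum_empty, zero_add, if_false]
    refine sum_eq_zero fun T hT => ?_
    have := sum_sdiff (f := w) (mem_powerset.1 hT)
    rw [if_neg (by omega)]

-- Dominating cut sets give the `hurwitz` term of `reducedHurwitz_insert`, the others its
-- `weightedHurwitz` term, both with parameter `1 + w i`.
open Classical in
theorem shift_blockWeight {α : Type*} [LinearOrder α] (B : Finset α) {i : ℕ} {S : Finset ℕ}
    (hi : ∀ s ∈ S, s < i) :
    SetFun.shift i (blockWeight w y B.card) S = ∑ E ∈ B.powersetCard (w i + 1),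
      (if Dominates E B then 1 else y i) * (∏ e ∈ E, blockWeight w y (arc B E e).card) S := by
  have hiS : i ∉ S := fun h => lt_irrefl _ (hi i h)
  rw [← sum_filter_add_sum_filter_not _ (Dominates · B)]
  have h1 : ∑ E ∈ (B.powersetCard (w i + 1)).filter (Dominates · B),
      (if Dominates E B then 1 else y i) * (∏ e ∈ E, blockWeight w y (arc B E e).card) S =
      compositionSum (blockWeight w y) (w i + 1) B.card S := by
    rw [← sum_arc_dominates, SetFun.sum_apply]
    exact sum_congr rfl fun E hE => by rw [if_pos (mem_filter.1 hE).2, one_mul]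
  have h2 : ∑ E ∈ (B.powersetCard (w i + 1)).filter (¬ Dominates · B),
      (if Dominates E B then 1 else y i) * (∏ e ∈ E, blockWeight w y (arc B E e).card) S =
      y i * if ∑ t ∈ S, w t + (w i + 1) = B.card then weightedHurwitz w y (1 + w i) S else 0 := by
    rw [← sum_shifted_compositionSum_blockWeight, ← sum_arc_not_dominates, SetFun.sum_apply,
      mul_sum]
    exact sum_congr rfl fun E hE => by rw [if_neg (mem_filter.1 hE).2]
  rw [h1, h2, compositionSum_blockWeight, SetFun.shift_apply, blockWeight_apply, hurwitz_insert,
    reducedHurwitz_insert w y _ hi, sum_insert hiS]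
  have h3 : w i + ∑ t ∈ S, w t + 1 = B.card ↔ ∑ t ∈ S, w t + (w i + 1) = B.card := by omega
  have h4 : ((w i + 1 : ℕ) : R) = 1 + w i := by push_cast; ring
  rw [if_congr h3 rfl rfl, h4]
  split_ifs <;> ring

end BlockWeight

end MinFact
namespace MinFact

open Finset

variable {n : ℕ}

/-! ### Cyclic successors and increasing cycles. -/

section CyclicSuccessor

variable {α : Type*} [LinearOrder α]

/-- `y` is the successor of `x` in `C`, in the cyclic order. -/
def IsCyclicNext (C : Finset α) (x y : α) : Prop :=
  y ∈ C ∧ ((x < y ∧ ∀ t ∈ C, x < t → y ≤ t) ∨ ((∀ t ∈ C, t ≤ x) ∧ ∀ t ∈ C, y ≤ t))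

theorem IsCyclicNext.unique {C : Finset α} {x y z : α} (hy : IsCyclicNext C x y)
    (hz : IsCyclicNext C x z) : y = z := by
  obtain ⟨hy, ⟨h1, h2⟩ | ⟨h1, h2⟩⟩ := hy <;> obtain ⟨hz, ⟨h3, h4⟩ | ⟨h3, h4⟩⟩ := hz
  · exact le_antisymm (h2 z hz h3) (h4 y hy h1)
  · exact absurd (h3 y hy) (not_le.2 h1)
  · exact absurd (h1 z hz) (not_le.2 h3)
  · exact le_antisymm (h2 z hz) (h4 y hy)

theorem IsCyclicNext.mono {C D : Finset α} {x y : α} (h : IsCyclicNext C x y) (hD : D ⊆ C)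
    (hy : y ∈ D) : IsCyclicNext D x y :=
  ⟨hy, h.2.imp (fun h => ⟨h.1, fun t ht => h.2 t (hD ht)⟩)
    (fun h => ⟨fun t ht => h.1 t (hD ht), fun t ht => h.2 t (hD ht)⟩)⟩

theorem isCyclicNext_formPerm {l : List α} (hl : l.SortedLT) {x : α} (hx : x ∈ l) :
    IsCyclicNext l.toFinset x (l.formPerm x) := by
  refine ⟨List.mem_toFinset.2 (List.formPerm_apply_mem_of_mem hx), ?_⟩
  obtain ⟨i, hi, rfl⟩ := List.mem_iff_getElem.1 hx
  have hmono : ∀ {a b : ℕ} (ha : a < l.length) (hb : b < l.length), l[a] < l[b] ↔ a < b := by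
    intro a b ha hb
    exact hl.getElem_lt_getElem_iff
  have hmono' : ∀ {a b : ℕ} (ha : a < l.length) (hb : b < l.length), l[a] ≤ l[b] ↔ a ≤ b := by
    intro a b ha hb
    rw [← not_lt, hmono hb ha, not_lt]
  by_cases h : i + 1 < l.length
  · left
    rw [List.formPerm_apply_lt_getElem _ hl.nodup _ h]
    refine ⟨(hmono _ _).2 (Nat.lt_succ_self i), fun t ht hit => ?_⟩
    obtain ⟨j, hj, rfl⟩ := List.mem_iff_getElem.1 (List.mem_toFinset.1 ht)
    exact (hmono' _ _).2 ((hmono _ _).1 hit)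
  · right
    have h0 : i + 1 = l.length := by omega
    rw [List.formPerm_apply_getElem _ hl.nodup]
    simp only [h0, Nat.mod_self]
    constructor
    · intro t ht
      obtain ⟨j, hj, rfl⟩ := List.mem_iff_getElem.1 (List.mem_toFinset.1 ht)
      exact (hmono' _ _).2 (by omega)
    · intro t ht
      obtain ⟨j, hj, rfl⟩ := List.mem_iff_getElem.1 (List.mem_toFinset.1 ht)
      exact (hmono' _ _).2 (by omega)

/-- The permutation that maps each element of `E` to its successor in the cyclic order of `E`. -/
def incCycle (E : Finset α) : Equiv.Perm α := (E.sort (· ≤ ·)).formPerm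

theorem incCycle_apply_of_notMem {E : Finset α} {x : α} (hx : x ∉ E) : incCycle E x = x :=
  List.formPerm_apply_of_notMem fun h => hx ((mem_sort _).1 h)

theorem isCyclicNext_incCycle {E : Finset α} {x : α} (hx : x ∈ E) :
    IsCyclicNext E x (incCycle E x) := by
  have := isCyclicNext_formPerm (sortedLT_sort E) ((mem_sort _).2 hx)
  rwa [sort_toFinset] at this

theorem eq_incCycle {E : Finset α} {z : Equiv.Perm α} (h1 : ∀ x ∉ E, z x = x)
    (h2 : ∀ x ∈ E, IsCyclicNext E x (z x)) : z = incCycle E := by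
  ext x
  by_cases hx : x ∈ E
  · exact (h2 x hx).unique (isCyclicNext_incCycle hx)
  · rw [h1 x hx, incCycle_apply_of_notMem hx]

theorem isCycle_incCycle {E : Finset α} (hE : 2 ≤ E.card) : (incCycle E).IsCycle :=
  List.isCycle_formPerm (sort_nodup _ _) (by rwa [length_sort])

theorem support_incCycle [Fintype α] {E : Finset α} (hE : 2 ≤ E.card) :
    (incCycle E).support = E := by
  rw [incCycle, List.support_formPerm_of_nodup _ (sort_nodup _ _), sort_toFinset]
  intro x hx
  have := congrArg List.length hx
  rw [length_sort, List.length_singleton] at this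
  omega

theorem incCycle_injOn [Fintype α] {E E' : Finset α} (hE : 2 ≤ E.card)
    (h : incCycle E = incCycle E') : E = E' := by
  by_cases hE' : 2 ≤ E'.card
  · rw [← support_incCycle hE, h, support_incCycle hE']
  · have : incCycle E' = 1 :=
      (List.formPerm_eq_one_iff _ (sort_nodup _ _)).2 (by rw [length_sort]; omega)
    exact absurd (h.trans this) (isCycle_incCycle hE).ne_one

theorem incCycle_pair {x y : α} (h : x < y) : incCycle {x, y} = Equiv.swap x y := by
  symm
  refine eq_incCycle (fun t ht => ?_) fun t ht => ?_
  · simp only [mem_insert, mem_singleton, not_or] at ht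
    exact Equiv.swap_apply_of_ne_of_ne ht.1 ht.2
  · rcases (by simpa using ht : t = x ∨ t = y) with rfl | rfl
    · rw [Equiv.swap_apply_left]
      refine ⟨by simp, Or.inl ⟨h, fun s hs hts => ?_⟩⟩
      rcases (by simpa using hs : s = t ∨ s = y) with rfl | rfl
      · exact absurd hts (lt_irrefl _)
      · exact le_rfl
    · rw [Equiv.swap_apply_right]
      refine ⟨by simp, Or.inr ⟨fun s hs => ?_, fun s hs => ?_⟩⟩ <;>
        rcases (by simpa using hs : s = x ∨ s = t) with rfl | rfl
      exacts [h.le, le_rfl, le_rfl, h.le]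

end CyclicSuccessor

/-! ### The permutation of a partition. -/

section BlockPerm

theorem blockPerm_isCyclicNext (π : Finpartition (univ : Finset (Fin n))) (x : Fin n) :
    IsCyclicNext (π.part x) x (blockPerm π x) :=
  ⟨nextInBlock_mem π x, nextInBlock_cases π x⟩

theorem blockPerm_eq {π : Finpartition (univ : Finset (Fin n))} {x y : Fin n}
    (h : IsCyclicNext (π.part x) x y) : blockPerm π x = y :=
  (blockPerm_isCyclicNext π x).unique h

theorem part_blockPerm (π : Finpartition (univ : Finset (Fin n))) (x : Fin n) :
    π.part (blockPerm π x) = π.part x :=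
  π.part_eq_of_mem (π.part_mem.2 (mem_univ _)) (blockPerm_isCyclicNext π x).1

/-- A function that is invariant under `blockPerm π` is constant on the blocks of `π`. -/
theorem eq_of_invariant {β : Type*} {π : Finpartition (univ : Finset (Fin n))} {f : Fin n → β}
    (hf : ∀ x, f (blockPerm π x) = f x) {B : Finset (Fin n)} (hB : B ∈ π.parts) {x y : Fin n}
    (hx : x ∈ B) (hy : y ∈ B) : f x = f y := by
  have hne : B.Nonempty := ⟨x, hx⟩
  -- Every element of `B` other than the smallest is the image of a smaller element of `B`, so
  -- induction goes down to the minimum.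
  have key : ∀ x, x ∈ B → f x = f (B.min' hne) := by
    intro x
    induction x using WellFoundedLT.induction with
    | ind x ih =>
    intro hx
    obtain ⟨t, rfl⟩ := (blockPerm π).surjective x
    have htB : π.part t = B := by rw [← part_blockPerm, π.part_eq_of_mem hB hx]
    have ht : t ∈ B := htB ▸ π.mem_part (mem_univ t)
    have hc := (blockPerm_isCyclicNext π t).2
    rw [htB] at hc
    rcases hc with ⟨h1, -⟩ | ⟨-, h2⟩
    · rw [hf, ih t h1 ht]
    · rw [le_antisymm (h2 _ (min'_mem B hne)) (min'_le _ _ hx)]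
  rw [key x hx, key y hy]

theorem finpartition_ext_part {π ρ : Finpartition (univ : Finset (Fin n))}
    (h : ∀ x, π.part x = ρ.part x) : π = ρ := by
  have key : ∀ {π ρ : Finpartition (univ : Finset (Fin n))}, (∀ x, π.part x = ρ.part x) →
      π.parts ⊆ ρ.parts := by
    intro π ρ h B hB
    obtain ⟨x, hx⟩ := π.nonempty_of_mem_parts hB
    rw [← π.part_eq_of_mem hB hx, h]
    exact ρ.part_mem.2 (mem_univ x)
  exact Finpartition.ext (subset_antisymm (key h) (key fun x => (h x).symm))

theorem blockPerm_injective :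
    Function.Injective (blockPerm : Finpartition (univ : Finset (Fin n)) → _) := by
  have key : ∀ {π ρ : Finpartition (univ : Finset (Fin n))}, blockPerm π = blockPerm ρ →
      ∀ x, π.part x ⊆ ρ.part x := by
    intro π ρ h x y hy
    have := eq_of_invariant (π := π) (f := ρ.part) (fun t => by rw [h, part_blockPerm])
      (π.part_mem.2 (mem_univ x)) (π.mem_part (mem_univ x)) hy
    rw [this]
    exact ρ.mem_part (mem_univ y)
  intro π ρ h
  exact finpartition_ext_part fun x => subset_antisymm (key h x) (key h.symm x)

theorem blockPerm_bot : blockPerm (⊥ : Finpartition (univ : Finset (Fin n))) = 1 := by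
  ext x : 1
  refine blockPerm_eq ?_
  have : (⊥ : Finpartition (univ : Finset (Fin n))).part x = {x} :=
    Finpartition.part_eq_of_mem _ (Finpartition.mem_bot_iff.2 ⟨x, mem_univ x, rfl⟩)
      (mem_singleton_self x)
  rw [this]
  exact ⟨mem_singleton_self x, Or.inr ⟨fun t ht => (mem_singleton.1 ht).le,
    fun t ht => (mem_singleton.1 ht).ge⟩⟩

theorem part_top (x : Fin n) : (⊤ : Finpartition (univ : Finset (Fin n))).part x = univ := by
  have h := Finpartition.parts_top_subset (univ : Finset (Fin n))
    ((⊤ : Finpartition (univ : Finset (Fin n))).part_mem.2 (mem_univ x))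
  exact mem_singleton.1 h

theorem blockPerm_top : blockPerm (⊤ : Finpartition (univ : Finset (Fin n))) = finRotate n := by
  ext x : 1
  refine blockPerm_eq ?_
  rw [part_top]
  refine ⟨mem_univ _, ?_⟩
  obtain ⟨m, rfl⟩ : ∃ m, n = m + 1 := ⟨n - 1, by have := x.2; omega⟩
  rcases eq_or_ne x (Fin.last m) with rfl | hx
  · right
    rw [finRotate_last]
    exact ⟨fun t _ => Fin.le_last t, fun t _ => Fin.zero_le t⟩
  · left
    have h := coe_finRotate_of_ne_last hx
    refine ⟨Fin.lt_def.2 (by omega), fun t _ ht => Fin.le_def.2 ?_⟩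
    have := Fin.lt_def.1 ht
    omega

end BlockPerm

/-! ### Cutting a block of a partition. -/

section Cut

open Classical in
/-- The partition obtained from `π` by cutting the block `B` after each element of `E`, in the
cyclic order of `B`. -/
noncomputable def cut (π : Finpartition (univ : Finset (Fin n))) (B E : Finset (Fin n)) :
    Finpartition (univ : Finset (Fin n)) :=
  Finpartition.ofSetoid (Setoid.ker fun x => (π.part x, if x ∈ B then some (label E x) else none))

variable {π : Finpartition (univ : Finset (Fin n))} {B E : Finset (Fin n)}

theorem mem_part_cut {x y : Fin n} : y ∈ (cut π B E).part x ↔ π.part x = π.part y ∧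
    (if x ∈ B then some (label E x) else none) = (if y ∈ B then some (label E y) else none) := by
  classical
  unfold cut
  rw [Finpartition.mem_part_ofSetoid_iff_rel, Setoid.ker_def, Prod.mk.injEq]

theorem part_cut_of_mem (hB : B ∈ π.parts) {x : Fin n} (hx : x ∈ B) :
    (cut π B E).part x = arc B E (label E x) := by
  ext y
  rw [mem_part_cut, mem_arc, if_pos hx, π.part_eq_of_mem hB hx, eq_comm, π.part_eq_iff_mem hB]
  refine and_congr_right fun hy => ?_
  rw [if_pos hy, Option.some_inj, eq_comm]

theorem part_cut_of_notMem (hB : B ∈ π.parts) {x : Fin n} (hx : x ∉ B) :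
    (cut π B E).part x = π.part x := by
  ext y
  rw [mem_part_cut, if_neg hx, π.mem_part_iff_part_eq_part (mem_univ y) (mem_univ x)]
  refine ⟨fun h => h.1.symm, fun h => ⟨h.symm, ?_⟩⟩
  rw [if_neg]
  intro hy
  rw [π.part_eq_of_mem hB hy] at h
  exact hx (h ▸ π.mem_part (mem_univ x))

theorem parts_cut (hB : B ∈ π.parts) (hEB : E ⊆ B) (hE : E.Nonempty) :
    (cut π B E).parts = π.parts.erase B ∪ E.image (arc B E) := by
  ext C
  rw [mem_union, mem_erase, mem_image]
  constructor
  · intro hC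
    obtain ⟨x, hx⟩ := (cut π B E).nonempty_of_mem_parts hC
    rw [← (cut π B E).part_eq_of_mem hC hx]
    by_cases hxB : x ∈ B
    · rw [part_cut_of_mem hB hxB]
      exact Or.inr ⟨_, (label_spec hE x).1, rfl⟩
    · rw [part_cut_of_notMem hB hxB]
      exact Or.inl ⟨fun h => hxB (h ▸ π.mem_part (mem_univ x)), π.part_mem.2 (mem_univ x)⟩
  · rintro (⟨hne, hC⟩ | ⟨e, he, rfl⟩)
    · obtain ⟨x, hx⟩ := π.nonempty_of_mem_parts hC
      have hxB : x ∉ B := fun h => hne (π.eq_of_mem_parts hC hB hx h)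
      rw [← π.part_eq_of_mem hC hx, ← part_cut_of_notMem (E := E) hB hxB]
      exact (cut π B E).part_mem.2 (mem_univ x)
    · have := part_cut_of_mem (E := E) hB (hEB he)
      rw [label_self he] at this
      rw [← this]
      exact (cut π B E).part_mem.2 (mem_univ _)

theorem self_mem_arc (hEB : E ⊆ B) {e : Fin n} (he : e ∈ E) : e ∈ arc B E e :=
  mem_arc.2 ⟨hEB he, label_self he⟩

theorem arc_injOn (hEB : E ⊆ B) : Set.InjOn (arc B E) E := by
  intro e he e' he' h
  have := self_mem_arc hEB he
  rw [h, mem_arc, label_self he] at this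
  exact this.2

theorem disjoint_erase_image_arc (hB : B ∈ π.parts) (hEB : E ⊆ B) :
    Disjoint (π.parts.erase B) (E.image (arc B E)) := by
  rw [disjoint_left]
  intro C hC hC'
  obtain ⟨e, he, rfl⟩ := mem_image.1 hC'
  exact (mem_erase.1 hC).1 (π.eq_of_mem_parts (mem_erase.1 hC).2 hB (self_mem_arc hEB he) (hEB he))

/-- Off `E`, the successor in `B` stays in the same arc. From `x ∈ E` it is the first element of the
next arc; `incCycle E` sends `x` to the end of that arc, which the cut partition sends back to its
first element. -/
theorem blockPerm_cut_mul_incCycle (hB : B ∈ π.parts) (hEB : E ⊆ B) (hE : E.Nonempty) :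
    blockPerm (cut π B E) * incCycle E = blockPerm π := by
  ext x : 1
  rw [Equiv.Perm.mul_apply]
  have hy := blockPerm_isCyclicNext π x
  set y := blockPerm π x
  refine blockPerm_eq ?_
  by_cases hxB : x ∈ B
  swap
  · rw [incCycle_apply_of_notMem fun h => hxB (hEB h), part_cut_of_notMem hB hxB]
    exact hy
  rw [π.part_eq_of_mem hB hxB] at hy
  by_cases hxE : x ∈ E
  · have hz := isCyclicNext_incCycle hxE
    set z := incCycle E x
    obtain ⟨hzE, hz⟩ := hz
    rw [part_cut_of_mem hB (hEB hzE), label_self hzE]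
    obtain ⟨hyB, hy⟩ := hy
    have hly : label E y = z := by
      refine label_eq hzE ?_
      rcases hy with ⟨hxy, hy⟩ | ⟨hx, hy⟩
      · rcases hz with ⟨hxz, hz⟩ | ⟨hx, hz⟩
        · exact Or.inl ⟨hy z (hEB hzE) hxz, fun e he hye => hz e he (hxy.trans_le hye)⟩
        · exact Or.inr ⟨fun e he => (hx e he).trans_lt hxy, hz⟩
      · rcases hz with ⟨hxz, hz⟩ | ⟨hx', hz⟩
        · exact absurd (hx z (hEB hzE)) (not_le.2 hxz)
        · exact Or.inl ⟨hy z (hEB hzE), fun e he _ => hz e he⟩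
    refine ⟨mem_arc.2 ⟨hyB, hly⟩, ?_⟩
    rcases hy with ⟨hxy, hy⟩ | ⟨hx, hy⟩
    · rcases hz with ⟨hxz, hz⟩ | ⟨hx, hz⟩
      · right
        have hxt : ∀ t ∈ arc B E z, x < t ∧ t ≤ z := by
          intro t ht
          obtain ⟨htB, ht⟩ := mem_arc.1 ht
          rcases (label_eq_iff hzE).1 ht with ⟨h1, h2⟩ | ⟨h1, h2⟩
          · exact ⟨lt_of_not_ge fun h => absurd (h2 x hxE h) (not_le.2 hxz), h1⟩
          · exact absurd (h2 x hxE) (not_le.2 hxz)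
        exact ⟨fun t ht => (hxt t ht).2, fun t ht => hy t (mem_arc.1 ht).1 (hxt t ht).1⟩
      · left
        refine ⟨(hz x hxE).trans_lt hxy, fun t ht hzt => ?_⟩
        obtain ⟨htB, ht⟩ := mem_arc.1 ht
        rcases (label_eq_iff hzE).1 ht with ⟨h1, h2⟩ | ⟨h1, h2⟩
        · exact absurd hzt (not_lt.2 h1)
        · exact hy t htB (h1 x hxE)
    · right
      refine ⟨fun t ht => ?_, fun t ht => hy t (mem_arc.1 ht).1⟩
      obtain ⟨htB, ht⟩ := mem_arc.1 ht
      rcases (label_eq_iff hzE).1 ht with ⟨h1, h2⟩ | ⟨h1, h2⟩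
      · exact h1
      · exact absurd (h1 x hxE) (not_lt.2 (hx t htB))
  · rw [incCycle_apply_of_notMem hxE, part_cut_of_mem hB hxB]
    refine hy.mono (filter_subset _ _) (mem_arc.2 ⟨hy.1, ?_⟩)
    obtain ⟨heE, he⟩ := label_spec hE x
    set e := label E x
    refine label_eq heE ?_
    obtain ⟨hyB, hy⟩ := hy
    rcases hy with ⟨hxy, hy⟩ | ⟨hx, hy⟩
    · rcases he with ⟨hxe, he⟩ | ⟨hx, he⟩
      · exact Or.inl ⟨hy e (hEB heE) (lt_of_le_of_ne hxe fun h => hxE (h ▸ heE)),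
          fun e' he' hye' => he e' he' (hxy.le.trans hye')⟩
      · exact Or.inr ⟨fun e' he' => (hx e' he').trans hxy, he⟩
    · rcases he with ⟨hxe, he⟩ | ⟨hx', he⟩
      · exact absurd (le_antisymm hxe (hx e (hEB heE))) fun h => hxE (h ▸ heE)
      · exact Or.inl ⟨hy e (hEB heE), fun e' he' _ => he e' he'⟩

/-- A crossing between different blocks of `π` is excluded, and inside one block the arcs are
disjoint cyclic intervals, which cannot cross. -/
theorem isNoncrossing_cut (hB : B ∈ π.parts) (hE : E.Nonempty) (hπ : IsNoncrossing π) :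
    IsNoncrossing (cut π B E) := by
  intro C hC D hD i hi j hj k hk l hl hij hjk hkl
  rw [← Finpartition.part_eq_of_mem _ hC hi, mem_part_cut] at hk
  rw [← Finpartition.part_eq_of_mem _ hD hj, mem_part_cut] at hl
  refine Finpartition.eq_of_mem_parts _ hC hD hi ?_
  rw [← Finpartition.part_eq_of_mem _ hD hj, mem_part_cut]
  have hpart : π.part i = π.part j := by
    refine hπ _ (π.part_mem.2 (mem_univ i)) _ (π.part_mem.2 (mem_univ j)) i
      (π.mem_part (mem_univ i)) j (π.mem_part (mem_univ j)) k ?_ l ?_ hij hjk hkl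
    · rw [hk.1]; exact π.mem_part (mem_univ k)
    · rw [hl.1]; exact π.mem_part (mem_univ l)
  refine ⟨hpart.symm, ?_⟩
  have hmem : ∀ {x y}, π.part x = π.part y → x ∈ B → y ∈ B := fun {x y} h hx => by
    rw [← π.part_eq_of_mem hB hx, h]; exact π.mem_part (mem_univ y)
  by_cases hiB : i ∈ B
  · have hjB := hmem hpart hiB
    have hkB := hmem hk.1 hiB
    have hlB := hmem hl.1 hjB
    simp only [if_pos, hiB, hjB, hkB, hlB, Option.some_inj] at hk hl ⊢
    obtain ⟨heE, hi⟩ := label_spec hE i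
    have hk := (label_eq_iff heE).1 hk.2.symm
    set e := label E i
    rcases hi with ⟨hi1, hi2⟩ | ⟨hi1, hi2⟩
    · rcases hk with ⟨hk1, hk2⟩ | ⟨hk1, hk2⟩
      · exact label_eq heE (Or.inl ⟨hjk.le.trans hk1, fun e' he' h => hi2 e' he' (hij.le.trans h)⟩)
      · rw [hl.2]
        exact label_eq heE (Or.inr ⟨fun e' he' => (hk1 e' he').trans hkl, hk2⟩)
    · exact label_eq heE (Or.inr ⟨fun e' he' => (hi1 e' he').trans hij, hi2⟩)
  · rw [if_neg hiB, if_neg fun h => hiB (hmem hpart.symm h)]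

end Cut

end MinFact
namespace MinFact

open Finset

variable {n : ℕ} {B : Finset (Fin n)}

/-! ### Interval and near interval partitions as cyclic cuts. -/

section Ends

/-- Recognizes a partition as a cyclic cut from a choice of the end `m C` of each block. -/
theorem parts_eq_image_arc (Q : Finpartition B) (m : Finset (Fin n) → Fin n) {E : Finset (Fin n)}
    (hE : E = Q.parts.image m) (hm : ∀ C ∈ Q.parts, m C ∈ C)
    (hl : ∀ C ∈ Q.parts, ∀ x ∈ C, label E x = m C) :
    E ⊆ B ∧ E.card = Q.parts.card ∧ Q.parts = E.image (arc B E) := by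
  have hinj : Set.InjOn m Q.parts := fun C hC D hD h =>
    Q.eq_of_mem_parts hC hD (hm C hC) (h ▸ hm D hD)
  have harc : ∀ C ∈ Q.parts, arc B E (m C) = C := by
    intro C hC
    ext x
    rw [mem_arc]
    refine ⟨fun ⟨hx, hlx⟩ => ?_, fun hx => ⟨Q.subset hC hx, hl C hC x hx⟩⟩
    obtain ⟨D, hD, hxD⟩ := Q.exists_mem hx
    rw [hl D hD x hxD] at hlx
    rwa [← hinj hD hC hlx]
  refine ⟨fun e he => ?_, ?_, ?_⟩
  · rw [hE] at he
    obtain ⟨C, hC, rfl⟩ := mem_image.1 he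
    exact Q.subset hC (hm C hC)
  · rw [hE, card_image_of_injOn hinj]
  · conv_rhs => rw [hE, image_image, ← hE]
    rw [image_congr (f := arc B E ∘ m) (g := id) fun C hC => harc C hC, image_id]

theorem exists_max (B : Finset (Fin n)) (hB : B.Nonempty) : ∃ m : Finset (Fin n) → Fin n,
    ∀ C : Finset (Fin n), C.Nonempty → m C ∈ C ∧ ∀ x ∈ C, x ≤ m C := by
  classical
  obtain ⟨x₀, -⟩ := hB
  refine ⟨fun C => if h : C.Nonempty then C.max' h else x₀, fun C hC => ?_⟩
  simp only [dif_pos hC]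
  exact ⟨max'_mem _ _, fun x hx => le_max' _ _ hx⟩

theorem IsIntervalPartition.max_le_max {Q : Finpartition B} (hQ : IsIntervalPartition Q)
    {m : Finset (Fin n) → Fin n}
    (hm : ∀ C : Finset (Fin n), C.Nonempty → m C ∈ C ∧ ∀ x ∈ C, x ≤ m C)
    {C D : Finset (Fin n)} (hC : C ∈ Q.parts) (hD : D ∈ Q.parts) {x : Fin n} (hx : x ∈ C)
    (hxD : x ≤ m D) : m C ≤ m D := by
  by_contra h
  have hCm := hm C (Q.nonempty_of_mem_parts hC)
  have hDm := hm D (Q.nonempty_of_mem_parts hD)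
  obtain ⟨a, -, b, -, hab⟩ := hQ C hC
  have hC' : ∀ t, t ∈ C ↔ t ∈ B ∧ a ≤ t ∧ t ≤ b := fun t => by
    conv_lhs => rw [hab]
    exact mem_filter
  have hmD : m D ∈ C := (hC' _).2 ⟨Q.subset hD hDm.1, ((hC' x).1 hx).2.1.trans hxD,
    (not_le.1 h).le.trans ((hC' _).1 hCm.1).2.2⟩
  have := Q.eq_of_mem_parts hC hD hmD hDm.1
  exact h (this ▸ le_rfl)

theorem IsIntervalPartition.exists_ends {Q : Finpartition B} (hQ : IsIntervalPartition Q)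
    (hB : B.Nonempty) : ∃ E ⊆ B, Dominates E B ∧ E.card = Q.parts.card ∧
      Q.parts = E.image (arc B E) := by
  obtain ⟨m, hm⟩ := exists_max B hB
  have hm' : ∀ C ∈ Q.parts, m C ∈ C ∧ ∀ x ∈ C, x ≤ m C :=
    fun C hC => hm C (Q.nonempty_of_mem_parts hC)
  obtain ⟨h1, h2, h3⟩ := parts_eq_image_arc Q m rfl (fun C hC => (hm' C hC).1) fun C hC x hx => by
    refine label_eq (mem_image_of_mem _ hC) (Or.inl ⟨(hm' C hC).2 x hx, fun e he hxe => ?_⟩)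
    obtain ⟨D, hD, rfl⟩ := mem_image.1 he
    exact hQ.max_le_max hm hC hD hx hxe
  refine ⟨_, h1, fun x hx => ?_, h2, h3⟩
  obtain ⟨C, hC, hxC⟩ := Q.exists_mem hx
  exact ⟨m C, mem_image_of_mem _ hC, (hm' C hC).2 x hxC⟩

theorem IsNearIntervalPartition.exists_ends {Q : Finpartition B} (hQ : IsNearIntervalPartition Q)
    (hB : B.Nonempty) : ∃ E ⊆ B, E.card = Q.parts.card ∧ Q.parts = E.image (arc B E) := by
  classical
  obtain ⟨P, hP, hP3, I, hI, J, hJ, hImin, hJmax, hparts⟩ := hQ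
  obtain ⟨m, hm⟩ := exists_max B hB
  have hm' : ∀ C ∈ P.parts, m C ∈ C ∧ ∀ x ∈ C, x ≤ m C :=
    fun C hC => hm C (P.nonempty_of_mem_parts hC)
  have hIJ : I ≠ J := by
    rintro rfl
    have hsub : P.parts ⊆ {I} := by
      intro K hK
      by_contra hne
      rw [mem_singleton] at hne
      exact lt_asymm (hImin K hK hne _ (hm' I hI).1 _ (hm' K hK).1)
        (hJmax K hK hne _ (hm' K hK).1 _ (hm' I hI).1)
    have := card_le_card hsub
    rw [card_singleton] at this
    omega
  have hne : ∀ C ∈ P.parts, C ≠ I → C ≠ I ∪ J := by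
    rintro C hC hCI rfl
    exact hCI (P.eq_of_mem_parts hC hI (mem_union_left _ (hm' I hI).1) (hm' I hI).1)
  -- In the cyclic order `J` precedes `I`, so the merged block ends in the maximum of `I`, and the
  -- maximum of `J` is no cut point.
  set m' : Finset (Fin n) → Fin n := fun C => if C = I ∪ J then m I else m C with hm'def
  set E := (P.parts.erase J).image m with hEdef
  have hE : E = Q.parts.image m' := by
    ext e
    rw [hEdef, hparts, image_insert, mem_insert, mem_image, mem_image]
    constructor
    · rintro ⟨C, hC, rfl⟩
      obtain ⟨hCJ, hC⟩ := mem_erase.1 hC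
      by_cases hCI : C = I
      · left
        simp only [hm'def, if_true, hCI]
      · right
        refine ⟨C, mem_erase.2 ⟨hCJ, mem_erase.2 ⟨hCI, hC⟩⟩, ?_⟩
        simp only [hm'def, if_neg (hne C hC hCI)]
    · rintro (rfl | ⟨C, hC, rfl⟩)
      · exact ⟨I, mem_erase.2 ⟨hIJ, hI⟩, by simp only [hm'def, if_true]⟩
      · obtain ⟨hCJ, hC⟩ := mem_erase.1 hC
        obtain ⟨hCI, hC⟩ := mem_erase.1 hC
        exact ⟨C, mem_erase.2 ⟨hCJ, hC⟩, by simp only [hm'def, if_neg (hne C hC hCI)]⟩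
  have hlab : ∀ C ∈ P.parts, C ≠ J → ∀ x ∈ C, label E x = m C := by
    intro C hC hCJ x hx
    refine label_eq (mem_image_of_mem _ (mem_erase.2 ⟨hCJ, hC⟩))
      (Or.inl ⟨(hm' C hC).2 x hx, fun e he hxe => ?_⟩)
    obtain ⟨D, hD, rfl⟩ := mem_image.1 he
    exact hP.max_le_max hm hC (mem_of_mem_erase hD) hx hxe
  have hlabJ : ∀ x ∈ J, label E x = m I := by
    intro x hx
    refine label_eq (mem_image_of_mem _ (mem_erase.2 ⟨hIJ, hI⟩))
      (Or.inr ⟨fun e he => ?_, fun e he => ?_⟩)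
    · obtain ⟨D, hD, rfl⟩ := mem_image.1 he
      obtain ⟨hDJ, hD⟩ := mem_erase.1 hD
      exact hJmax D hD hDJ _ (hm' D hD).1 x hx
    · obtain ⟨D, hD, rfl⟩ := mem_image.1 he
      by_cases hDI : D = I
      · rw [hDI]
      · have hD := mem_of_mem_erase hD
        exact (hImin D hD hDI _ (hm' I hI).1 _ (hm' D hD).1).le
  have hQ : ∀ C ∈ Q.parts, C = I ∪ J ∨ (C ∈ P.parts ∧ C ≠ I ∧ C ≠ J) := by
    intro C hC
    rw [hparts, mem_insert, mem_erase, mem_erase] at hC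
    tauto
  obtain ⟨h1, h2, h3⟩ := parts_eq_image_arc Q m' hE
    (fun C hC => by
      rcases hQ C hC with rfl | ⟨hC, hCI, hCJ⟩
      · simp only [hm'def, if_true]
        exact mem_union_left _ (hm' I hI).1
      · simp only [hm'def, if_neg (hne C hC hCI)]
        exact (hm' C hC).1)
    (fun C hC x hx => by
      rcases hQ C hC with rfl | ⟨hC, hCI, hCJ⟩
      · simp only [hm'def, if_true]
        rcases mem_union.1 hx with hx | hx
        · exact hlab I hI hIJ x hx
        · exact hlabJ x hx
      · simp only [hm'def, if_neg (hne C hC hCI)]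
        exact hlab C hC hCJ x hx)
  exact ⟨E, h1, h2, h3⟩

variable {E : Finset (Fin n)}

/-- The partition of `B` into the cyclic intervals that end in the elements of `E`. -/
def arcPartition (hEB : E ⊆ B) (hE : E.Nonempty) : Finpartition B :=
  Finpartition.ofExistsUnique (E.image (arc B E))
    (fun C hC => by
      obtain ⟨e, he, rfl⟩ := mem_image.1 hC
      exact filter_subset _ _)
    (fun x hx => by
      refine ⟨arc B E (label E x), ⟨mem_image_of_mem _ (label_spec hE x).1, mem_arc.2 ⟨hx, rfl⟩⟩, ?_⟩
      rintro C ⟨hC, hxC⟩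
      obtain ⟨e, he, rfl⟩ := mem_image.1 hC
      rw [(mem_arc.1 hxC).2])
    (fun h => by
      obtain ⟨e, he, h⟩ := mem_image.1 h
      exact ne_empty_of_mem (self_mem_arc hEB he) h)

theorem parts_arcPartition (hEB : E ⊆ B) (hE : E.Nonempty) :
    (arcPartition hEB hE).parts = E.image (arc B E) := rfl

theorem Dominates.mem_arc_iff (hd : Dominates E B) {e x : Fin n} (he : e ∈ E) :
    x ∈ arc B E e ↔ x ∈ B ∧ x ≤ e ∧ ∀ e' ∈ E, x ≤ e' → e ≤ e' := by
  rw [mem_arc, label_eq_iff he]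
  refine and_congr_right fun hx => or_iff_left ?_
  rintro ⟨h, -⟩
  obtain ⟨e', he', hxe'⟩ := hd x hx
  exact absurd (h e' he') (not_lt.2 hxe')

theorem isIntervalPartition_arcPartition (hEB : E ⊆ B) (hE : E.Nonempty) (hd : Dominates E B) :
    IsIntervalPartition (arcPartition hEB hE) := by
  intro C hC
  obtain ⟨e, he, rfl⟩ := mem_image.1 hC
  have hne : (arc B E e).Nonempty := ⟨e, self_mem_arc hEB he⟩
  have ha := (hd.mem_arc_iff he).1 (min'_mem _ hne)
  refine ⟨(arc B E e).min' hne, ha.1, e, hEB he, ?_⟩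
  ext t
  rw [mem_filter]
  constructor
  · intro ht
    have ht' := (hd.mem_arc_iff he).1 ht
    exact ⟨ht'.1, min'_le _ _ ht, ht'.2.1⟩
  · rintro ⟨htB, hat, hte⟩
    exact (hd.mem_arc_iff he).2 ⟨htB, hte, fun e' he' h => ha.2.2 e' he' (hat.trans h)⟩

theorem isNearIntervalPartition_arcPartition (hEB : E ⊆ B) (hE : E.Nonempty) (hE2 : 2 ≤ E.card)
    (hd : ¬ Dominates E B) : IsNearIntervalPartition (arcPartition hEB hE) := by
  have hB : B.Nonempty := hE.mono hEB
  set M := B.max' hB with hMdef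
  have hMB : M ∈ B := max'_mem _ _
  have hleM : ∀ x ∈ B, x ≤ M := fun x hx => le_max' _ _ hx
  have hME : M ∉ E := fun h => hd fun x hx => ⟨M, h, hleM x hx⟩
  -- Adding the largest element of `B` as a cut point separates the wrapped piece, which gives the
  -- interval partition to be merged. It has at least three blocks since `E` has at least two
  -- elements.
  set F := insert M E with hFdef
  have hFB : F ⊆ B := insert_subset hMB hEB
  have hF : F.Nonempty := insert_nonempty _ _
  have hFd : Dominates F B := fun x hx => ⟨M, mem_insert_self _ _, hleM x hx⟩
  set e₀ := E.min' hE with he₀def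
  have he₀E : e₀ ∈ E := min'_mem _ _
  have he₀ : ∀ e ∈ E, e₀ ≤ e := fun e he => min'_le _ _ he
  have he₀F : e₀ ∈ F := mem_insert_of_mem he₀E
  have hMF : M ∈ F := mem_insert_self _ _
  have hFle : ∀ e ∈ F, e₀ ≤ e := fun e he => by
    rcases mem_insert.1 he with rfl | he
    · exact hleM _ (hEB he₀E)
    · exact he₀ e he
  have hinj : Set.InjOn (arc B F) F := arc_injOn hFB
  refine ⟨arcPartition hFB hF, isIntervalPartition_arcPartition hFB hF hFd, ?_,
    arc B F e₀, mem_image_of_mem _ he₀F, arc B F M, mem_image_of_mem _ hMF, ?_, ?_, ?_⟩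
  · rw [parts_arcPartition, card_image_of_injOn hinj, card_insert_of_notMem hME]
    omega
  · intro K hK hne x hx y hy
    obtain ⟨e, he, rfl⟩ := mem_image.1 hK
    have hx := (hFd.mem_arc_iff he₀F).1 hx
    have hy := (hFd.mem_arc_iff he).1 hy
    refine hx.2.1.trans_lt (lt_of_not_ge fun h => hne ?_)
    rw [le_antisymm (hy.2.2 e₀ he₀F h) (hFle e he)]
  · intro K hK hne x hx y hy
    obtain ⟨e, he, rfl⟩ := mem_image.1 hK
    have hx := (hFd.mem_arc_iff he).1 hx
    have hy := (hFd.mem_arc_iff hMF).1 hy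
    refine lt_of_not_ge fun h => hne ?_
    rw [le_antisymm (hleM e (hFB he)) (hy.2.2 e he (h.trans hx.2.1))]
  · have h1 : arc B E e₀ = arc B F e₀ ∪ arc B F M := by
      ext x
      rw [mem_union, mem_arc, label_eq_iff he₀E, hFd.mem_arc_iff he₀F, hFd.mem_arc_iff hMF]
      constructor
      · rintro ⟨hx, ⟨h1, -⟩ | ⟨h1, -⟩⟩
        · exact Or.inl ⟨hx, h1, fun e he _ => hFle e he⟩
        · refine Or.inr ⟨hx, hleM x hx, fun e he hxe => ?_⟩
          rcases mem_insert.1 he with rfl | he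
          · exact le_rfl
          · exact absurd (h1 e he) (not_lt.2 hxe)
      · rintro (⟨hx, h1, -⟩ | ⟨hx, -, h2⟩)
        · exact ⟨hx, Or.inl ⟨h1, fun e he _ => he₀ e he⟩⟩
        · refine ⟨hx, Or.inr ⟨fun e he => lt_of_not_ge fun h => hME ?_, he₀⟩⟩
          rw [le_antisymm (h2 e (mem_insert_of_mem he) h) (hleM e (hEB he))]
          exact he
    have h2 : ∀ e ∈ E, e ≠ e₀ → arc B E e = arc B F e := by
      intro e he hne
      ext x
      rw [mem_arc, label_eq_iff he, hFd.mem_arc_iff (mem_insert_of_mem he)]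
      refine and_congr_right fun hx => ?_
      constructor
      · rintro (⟨h1, h2⟩ | ⟨-, h2⟩)
        · refine ⟨h1, fun e' he' hxe' => ?_⟩
          rcases mem_insert.1 he' with rfl | he'
          · exact hleM e (hEB he)
          · exact h2 e' he' hxe'
        · exact absurd (le_antisymm (h2 e₀ he₀E) (he₀ e he)) hne
      · rintro ⟨h1, h2⟩
        exact Or.inl ⟨h1, fun e' he' => h2 e' (mem_insert_of_mem he')⟩
    rw [parts_arcPartition, parts_arcPartition, ← h1]
    ext C
    rw [mem_insert, mem_erase, mem_erase, mem_image, mem_image]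
    constructor
    · rintro ⟨e, he, rfl⟩
      by_cases hne : e = e₀
      · exact Or.inl (by rw [hne])
      · refine Or.inr ⟨?_, ?_, e, mem_insert_of_mem he, (h2 e he hne).symm⟩
        · rw [h2 e he hne]
          exact fun h => hME (hinj (mem_insert_of_mem he) hMF h ▸ he)
        · rw [h2 e he hne]
          exact fun h => hne (hinj (mem_insert_of_mem he) he₀F h)
    · rintro (rfl | ⟨h3, h4, e, he, rfl⟩)
      · exact ⟨e₀, he₀E, rfl⟩
      · rcases mem_insert.1 he with rfl | he
        · exact absurd rfl h3
        · exact ⟨e, he, h2 e he fun h => h4 (by rw [h])⟩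

variable {π ρ : Finpartition (univ : Finset (Fin n))}

theorem eq_cut_of_isSplitting {Q : Finpartition B} (h : IsSplitting ρ π B Q) (hEB : E ⊆ B)
    (hE : E.Nonempty) (hQ : Q.parts = E.image (arc B E)) : ρ = cut π B E := by
  refine Finpartition.ext ?_
  rw [h.2, parts_cut h.1 hEB hE, hQ]

theorem isSplitting_cut (hB : B ∈ π.parts) (hEB : E ⊆ B) (hE : E.Nonempty) :
    IsSplitting (cut π B E) π B (arcPartition hEB hE) :=
  ⟨hB, parts_cut hB hEB hE⟩

theorem splitsInto_iff {k : ℕ} (hk : 2 ≤ k) : SplitsInto k ρ π ↔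
    ∃ B ∈ π.parts, ∃ E ⊆ B, E.card = k ∧ ρ = cut π B E := by
  constructor
  · rintro ⟨B, Q, hs, hQk, hQ⟩
    have hB := π.nonempty_of_mem_parts hs.1
    obtain ⟨E, hEB, hEk, hE⟩ : ∃ E ⊆ B, E.card = Q.parts.card ∧ Q.parts = E.image (arc B E) := by
      rcases hQ with hQ | hQ
      · obtain ⟨E, h1, -, h2⟩ := hQ.exists_ends hB
        exact ⟨E, h1, h2⟩
      · exact hQ.exists_ends hB
    exact ⟨B, hs.1, E, hEB, hEk.trans hQk,
      eq_cut_of_isSplitting hs hEB (card_pos.1 (by omega)) hE⟩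
  · rintro ⟨B, hB, E, hEB, hEk, rfl⟩
    have hE : E.Nonempty := card_pos.1 (by omega)
    refine ⟨B, arcPartition hEB hE, isSplitting_cut hB hEB hE, ?_, ?_⟩
    · rw [parts_arcPartition, card_image_of_injOn (arc_injOn hEB), hEk]
    · by_cases hd : Dominates E B
      · exact Or.inl (isIntervalPartition_arcPartition hEB hE hd)
      · exact Or.inr (isNearIntervalPartition_arcPartition hEB hE (by omega) hd)

theorem incCycle_eq_of_cut (hB : B ∈ π.parts) (hEB : E ⊆ B) (hE : E.Nonempty) :
    (blockPerm (cut π B E))⁻¹ * blockPerm π = incCycle E := by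
  rw [← blockPerm_cut_mul_incCycle hB hEB hE, inv_mul_cancel_left]

/-- The cut determines the cycle `σ_ρ⁻¹ σ_π`, whose support is `E`, and `B` is the block of `π`
containing `E`. -/
theorem cut_injective {B' E' : Finset (Fin n)} (hB : B ∈ π.parts) (hEB : E ⊆ B) (hE : 2 ≤ E.card)
    (hB' : B' ∈ π.parts) (hEB' : E' ⊆ B') (hE' : E'.Nonempty) (h : cut π B E = cut π B' E') :
    B = B' ∧ E = E' := by
  have hEne : E.Nonempty := card_pos.1 (by omega)
  obtain rfl : E = E' := incCycle_injOn hE (by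
    rw [← incCycle_eq_of_cut hB hEB hEne, h, incCycle_eq_of_cut hB' hEB' hE'])
  obtain ⟨e, he⟩ := hEne
  exact ⟨π.eq_of_mem_parts hB hB' (hEB he) (hEB' he), rfl⟩

theorem intervalSplit_cut_iff (hB : B ∈ π.parts) (hEB : E ⊆ B) (hE : 2 ≤ E.card) :
    IntervalSplit (cut π B E) π ↔ Dominates E B := by
  have hEne : E.Nonempty := card_pos.1 (by omega)
  constructor
  · rintro ⟨B', Q, hs, hQ⟩
    obtain ⟨x, hx⟩ := π.nonempty_of_mem_parts hs.1
    obtain ⟨E', hEB', hd, -, hE'⟩ := hQ.exists_ends ⟨x, hx⟩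
    have hE'ne : E'.Nonempty := (hd x hx).imp fun _ h => h.1
    obtain ⟨rfl, rfl⟩ := cut_injective hB hEB hE hs.1 hEB' hE'ne
      (eq_cut_of_isSplitting hs hEB' hE'ne hE')
    exact hd
  · exact fun hd => ⟨B, arcPartition hEB hEne, isSplitting_cut hB hEB hEne,
      isIntervalPartition_arcPartition hEB hEne hd⟩

end Ends

end MinFact
namespace MinFact

open Finset

variable {n : ℕ}

/-! ### The number of cycles as a dimension. -/

section FixedSpace

/-- The space of the functions that are invariant under the permutation `u`. -/
def fixedSpace (u : Equiv.Perm (Fin n)) : Submodule ℚ (Fin n → ℚ) where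
  carrier := {f | ∀ x, f (u x) = f x}
  add_mem' := fun hf hg x => by simp only [Pi.add_apply, hf x, hg x]
  zero_mem' := fun _ => rfl
  smul_mem' := fun c f hf x => by simp only [Pi.smul_apply, hf x]

/-- The dimension of the fixed space of `u`, which is the number of cycles of `u`. -/
noncomputable def fixedDim (u : Equiv.Perm (Fin n)) : ℕ := Module.finrank ℚ (fixedSpace u)

theorem mem_fixedSpace_of_mul_swap {u : Equiv.Perm (Fin n)} {x y : Fin n} {f : Fin n → ℚ}
    (hf : f ∈ fixedSpace (u * Equiv.swap x y)) (hxy : f x = f y) : f ∈ fixedSpace u := by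
  intro t
  have h := hf (Equiv.swap x y t)
  rw [Equiv.Perm.mul_apply, Equiv.swap_apply_self] at h
  rw [h]
  by_cases hx : t = x
  · rw [hx, Equiv.swap_apply_left, hxy]
  · by_cases hy : t = y
    · rw [hy, Equiv.swap_apply_right, hxy]
    · rw [Equiv.swap_apply_of_ne_of_ne hx hy]

/-- The functions in the fixed space of the product that agree at `x` and `y` are fixed by `u`, and
this is a single linear condition. -/
theorem fixedDim_mul_swap_le (u : Equiv.Perm (Fin n)) (x y : Fin n) :
    fixedDim (u * Equiv.swap x y) ≤ fixedDim u + 1 := by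
  let φ : fixedSpace (u * Equiv.swap x y) →ₗ[ℚ] ℚ :=
    (LinearMap.proj (R := ℚ) (φ := fun _ : Fin n => ℚ) x -
      LinearMap.proj (R := ℚ) (φ := fun _ : Fin n => ℚ) y).domRestrict _
  have h1 := φ.finrank_range_add_finrank_ker
  have h2 : Module.finrank ℚ (LinearMap.range φ) ≤ 1 := by
    have := (LinearMap.range φ).finrank_le
    rwa [Module.finrank_self] at this
  have hmem : ∀ f : LinearMap.ker φ, (f : Fin n → ℚ) ∈ fixedSpace u := fun f =>
    mem_fixedSpace_of_mul_swap f.1.2 (sub_eq_zero.1 (LinearMap.mem_ker.1 f.2))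
  let ψ : LinearMap.ker φ →ₗ[ℚ] fixedSpace u :=
    LinearMap.codRestrict _ ((fixedSpace _).subtype ∘ₗ (LinearMap.ker φ).subtype) hmem
  have hψ : Function.Injective ψ := by
    intro f g h
    exact Subtype.ext (Subtype.ext (congrArg (fun t : fixedSpace u => (t : Fin n → ℚ)) h))
  have h3 := LinearMap.finrank_le_finrank_of_injective hψ
  unfold fixedDim
  omega

/-- Joining two cycles gains nothing. Summing an invariant `f` over the block of `y` before and
after applying `blockPerm π` leaves only the terms at `y`; since the product maps `x` to `blockPerm
π y`, this gives `f x = f y`. -/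
theorem fixedDim_mul_swap_le_of_part_ne {π : Finpartition (univ : Finset (Fin n))} {x y : Fin n}
    (h : y ∉ π.part x) : fixedDim (blockPerm π * Equiv.swap x y) ≤ fixedDim (blockPerm π) := by
  refine Submodule.finrank_mono fun f hf => mem_fixedSpace_of_mul_swap hf ?_
  have hinv : ∀ t, t ∈ π.part y ↔ blockPerm π t ∈ π.part y := fun t => by
    rw [π.mem_part_iff_part_eq_part (mem_univ _) (mem_univ _),
      π.mem_part_iff_part_eq_part (mem_univ _) (mem_univ _), part_blockPerm]
  have hsum : ∑ t ∈ π.part y, f (blockPerm π t) = ∑ t ∈ π.part y, f t :=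
    sum_equiv (blockPerm π) hinv fun _ _ => rfl
  have hyy : y ∈ π.part y := π.mem_part (mem_univ y)
  have hxy : ∀ t ∈ π.part y, t ≠ x := by
    rintro t ht rfl
    rw [π.mem_part_iff_part_eq_part (mem_univ _) (mem_univ _)] at h ht
    exact h ht.symm
  rw [← add_sum_erase _ _ hyy, ← add_sum_erase _ _ hyy] at hsum
  have hrest : ∑ t ∈ (π.part y).erase y, f (blockPerm π t) = ∑ t ∈ (π.part y).erase y, f t := by
    refine sum_congr rfl fun t ht => ?_
    obtain ⟨hty, ht⟩ := mem_erase.1 ht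
    have := hf t
    rwa [Equiv.Perm.mul_apply, Equiv.swap_apply_of_ne_of_ne (hxy t ht) hty] at this
  have hfx := hf x
  rw [Equiv.Perm.mul_apply, Equiv.swap_apply_left] at hfx
  rw [← hfx]
  linarith

theorem fixedDim_mul_formPerm_le (l : List (Fin n)) (u : Equiv.Perm (Fin n)) (x : Fin n) :
    fixedDim (u * (x :: l).formPerm) ≤ fixedDim u + l.length := by
  induction l generalizing u x with
  | nil => simp
  | cons y l ih =>
    rw [List.formPerm_cons_cons, ← mul_assoc, List.length_cons]
    have h1 := ih (u * Equiv.swap x y) y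
    have h2 := fixedDim_mul_swap_le u x y
    omega

theorem fixedDim_one : fixedDim (1 : Equiv.Perm (Fin n)) = n := by
  have : fixedSpace (1 : Equiv.Perm (Fin n)) = ⊤ := by
    rw [eq_top_iff]
    exact fun f _ x => rfl
  rw [fixedDim, this, finrank_top, Module.finrank_fin_fun]

theorem fixedDim_finRotate_le : fixedDim (finRotate n) ≤ 1 := by
  rw [← blockPerm_top]
  refine finrank_le_one (⟨fun _ => 1, fun _ => rfl⟩ : fixedSpace _) fun f => ?_
  rcases Nat.eq_zero_or_pos n with rfl | hn
  · exact ⟨0, Subtype.ext (funext fun x => x.elim0)⟩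
  · refine ⟨f.1 ⟨0, hn⟩, Subtype.ext (funext fun x => ?_)⟩
    have h : ∀ x, x ∈ (⊤ : Finpartition (univ : Finset (Fin n))).part ⟨0, hn⟩ := fun x => by
      rw [part_top]; exact mem_univ x
    have := eq_of_invariant (f := f.1) f.2 (Finpartition.part_mem _ |>.2 (mem_univ ⟨0, hn⟩))
      (h ⟨0, hn⟩) (h x)
    simpa using this

end FixedSpace

/-! ### Factors that gain the maximal number of cycles. -/

section Factor

theorem blockPerm_mul_swap {π : Finpartition (univ : Finset (Fin n))} {x y : Fin n}
    (hy : y ∈ π.part x) (h : y < x) :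
    blockPerm π * Equiv.swap x y = blockPerm (cut π (π.part x) {y, x}) := by
  have hsub : {y, x} ⊆ π.part x :=
    insert_subset hy (singleton_subset_iff.2 (π.mem_part (mem_univ x)))
  have := blockPerm_cut_mul_incCycle (π.part_mem.2 (mem_univ x)) hsub (insert_nonempty _ _)
  rw [← this, incCycle_pair h, Equiv.swap_comm, mul_assoc, Equiv.swap_mul_self, mul_one]

/-- The cycle is a product of transpositions along the list, and each must gain one dimension. So
`x` and the next entry `y` lie in one block, `hle` makes `y` smaller, and multiplying by the
transposition cuts this block after `y` and `x`; then `y` takes the role of `x`. -/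
theorem pairwise_of_fixedDim_maximal (l : List (Fin n)) (π : Finpartition (univ : Finset (Fin n)))
    (x : Fin n) (hnd : (x :: l).Nodup) (hle : ∀ y ∈ l, y ∈ π.part x → y ≤ x)
    (hdim : fixedDim (blockPerm π) + l.length ≤ fixedDim (blockPerm π * (x :: l).formPerm)) :
    (x :: l).Pairwise (· > ·) ∧ ∀ y ∈ l, y ∈ π.part x := by
  induction l generalizing π x with
  | nil => simp
  | cons y l ih =>
    rw [List.formPerm_cons_cons, ← mul_assoc, List.length_cons] at hdim
    have hle1 := fixedDim_mul_formPerm_le l (blockPerm π * Equiv.swap x y) y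
    have hy : y ∈ π.part x := by
      by_contra hy
      have := fixedDim_mul_swap_le_of_part_ne hy
      omega
    have hyx : y < x := lt_of_le_of_ne (hle y List.mem_cons_self hy) fun h =>
      (List.nodup_cons.1 hnd).1 (h ▸ List.mem_cons_self)
    have hle2 := fixedDim_mul_swap_le (blockPerm π) x y
    rw [blockPerm_mul_swap hy hyx] at hdim hle1 hle2
    have hpart : (cut π (π.part x) {y, x}).part y = arc (π.part x) {y, x} y := by
      rw [part_cut_of_mem (π.part_mem.2 (mem_univ x)) hy, label_self (by simp)]
    -- The arc of `y` consists of elements up to `y` and elements above `x`; the latter do not occur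
    -- in the list by `hle`.
    obtain ⟨h1, h2⟩ := ih _ y (List.nodup_cons.1 hnd).2 (fun t ht htp => by
      rw [hpart, mem_arc, label_eq_iff (by simp)] at htp
      rcases htp.2 with h | h
      · exact h.1
      · exact absurd (h.1 x (by simp)) (not_lt.2 (hle t (List.mem_cons_of_mem _ ht) htp.1)))
      (by omega)
    refine ⟨List.pairwise_cons.2 ⟨fun t ht => ?_, h1⟩, fun t ht => ?_⟩
    · rcases List.mem_cons.1 ht with rfl | ht
      · exact hyx
      · exact ((List.pairwise_cons.1 h1).1 t ht).trans hyx
    · rcases List.mem_cons.1 ht with rfl | ht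
      · exact hy
      · have := h2 t ht
        rw [hpart] at this
        exact (mem_arc.1 this).1

/-- Listing the inverse cycle from the largest element of its support supplies the order hypothesis
of `pairwise_of_fixedDim_maximal`. -/
theorem exists_inv_eq_formPerm {z : Equiv.Perm (Fin n)} (hz : z.IsCycle) :
    ∃ x l, z⁻¹ = (x :: l).formPerm ∧ (x :: l).Nodup ∧ (x :: l).length = z.support.card ∧
      ∀ y ∈ l, y ≤ x := by
  have hne : z.support.Nonempty := card_pos.1 (by have := hz.two_le_card_support; omega)
  set x := z.support.max' hne
  have hx : x ∈ z⁻¹.support := by rw [Equiv.Perm.support_inv]; exact max'_mem _ _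
  have hz' := hz.inv
  have hcyc : ∀ (_ : DecidableRel z⁻¹.SameCycle), z⁻¹.cycleOf x = z⁻¹ :=
    fun _ => hz'.cycleOf_eq (Equiv.Perm.mem_support.1 hx)
  have hform : (z⁻¹.toList x).formPerm = z⁻¹ := by
    rw [Equiv.Perm.formPerm_toList, hcyc]
  have hlen : (z⁻¹.toList x).length = z.support.card := by
    rw [Equiv.Perm.length_toList, hcyc, Equiv.Perm.support_inv]
  have hpos := Equiv.Perm.length_toList_pos_of_mem_support _ _ hx
  have h0 : (z⁻¹.toList x)[0]? = some x := by
    rw [List.getElem?_eq_getElem hpos, Equiv.Perm.toList_getElem_zero _ _ hx]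
  have hnd := Equiv.Perm.nodup_toList z⁻¹ x
  have hsupp : ∀ y ∈ z⁻¹.toList x, y ≤ x := fun y hy => by
    rw [Equiv.Perm.mem_toList_iff] at hy
    refine le_max' _ _ ?_
    rw [← Equiv.Perm.support_inv, Equiv.Perm.mem_support]
    exact fun h => Equiv.Perm.mem_support.1 hx ((hy.1.apply_eq_self_iff).2 h)
  generalize z⁻¹.toList x = L at *
  cases L with
  | nil => simp at hpos
  | cons x' l =>
    have h0 : x' = x := by simpa using h0
    exact ⟨x', l, hform.symm, hnd, hlen, fun y hy => h0 ▸ hsupp y (List.mem_cons_of_mem _ hy)⟩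

theorem fixedDim_mul_inv_le (u : Equiv.Perm (Fin n)) {z : Equiv.Perm (Fin n)} (hz : z.IsCycle) :
    fixedDim (u * z⁻¹) ≤ fixedDim u + (z.support.card - 1) := by
  obtain ⟨x, l, h1, -, h2, -⟩ := exists_inv_eq_formPerm hz
  rw [h1, ← h2]
  exact fixedDim_mul_formPerm_le l u x

theorem exists_cut_of_fixedDim_maximal (π : Finpartition (univ : Finset (Fin n)))
    {z : Equiv.Perm (Fin n)} (hz : z.IsCycle)
    (hdim : fixedDim (blockPerm π) + (z.support.card - 1) ≤ fixedDim (blockPerm π * z⁻¹)) :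
    ∃ B ∈ π.parts, ∃ E ⊆ B, E.card = z.support.card ∧
      blockPerm (cut π B E) * z = blockPerm π := by
  obtain ⟨x, l, hform, hnd, hlen, hle⟩ := exists_inv_eq_formPerm hz
  rw [hform, ← hlen] at hdim
  obtain ⟨hpw, hpart⟩ := pairwise_of_fixedDim_maximal l π x hnd (fun y hy _ => hle y hy) hdim
  have hz' : z = (x :: l).reverse.formPerm := by rw [List.formPerm_reverse, ← hform, inv_inv]
  have hsorted : (x :: l).reverse.SortedLT :=
    List.Pairwise.sortedLT (List.pairwise_reverse.2 hpw)
  set E := (x :: l).toFinset with hEdef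
  have hEl : E = (x :: l).reverse.toFinset := by rw [List.toFinset_reverse]
  have hzE : z = incCycle E := by
    refine eq_incCycle (fun t ht => ?_) fun t ht => ?_
    · rw [hz']
      exact List.formPerm_apply_of_notMem fun h => ht (hEl ▸ List.mem_toFinset.2 h)
    · rw [hEl] at ht
      rw [hEl, hz']
      exact isCyclicNext_formPerm hsorted (List.mem_toFinset.1 ht)
  have hEB : E ⊆ π.part x := fun t ht => by
    rcases List.mem_cons.1 (List.mem_toFinset.1 ht) with rfl | ht
    · exact π.mem_part (mem_univ t)
    · exact hpart t ht
  have hEne : E.Nonempty := ⟨x, by simp [hEdef]⟩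
  refine ⟨π.part x, π.part_mem.2 (mem_univ x), E, hEB, ?_, ?_⟩
  · rw [hEdef, List.toFinset_card_of_nodup hnd, hlen]
  · rw [hzE]
    exact blockPerm_cut_mul_incCycle (π.part_mem.2 (mem_univ x)) hEB hEne

end Factor

/-! ### Chains and minimal factorizations. -/

section Bijection

theorem prod_ofFn_inv_mul {G : Type*} [Group G] {r : ℕ} (u : Fin (r + 1) → G) :
    (List.ofFn fun i : Fin r => (u i.castSucc)⁻¹ * u i.succ).prod = (u 0)⁻¹ * u (Fin.last r) := by
  induction r with
  | zero => simp
  | succ r ih =>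
    rw [List.ofFn_succ, List.prod_cons]
    have := ih (fun i => u i.succ)
    simp only [Fin.succ_castSucc] at this
    simp only [Fin.castSucc_zero, ← Fin.succ_castSucc] at this ⊢
    rw [this, Fin.succ_last, Fin.succ_zero_eq_one]
    group

variable {r : ℕ} {a : Fin r → ℕ}

theorem mem_factorizations {z : Fin r → Equiv.Perm (Fin n)} : z ∈ factorizations n a ↔
    (List.ofFn z).prod = finRotate n ∧ ∀ i, (z i).IsCycle ∧ (z i).support.card = a i := by
  classical
  unfold factorizations
  rw [mem_filter, and_iff_right (mem_univ z)]

theorem mapsTo_chainToFactors (ha : ∀ i, 2 ≤ a i) :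
    Set.MapsTo chainToFactors (chains n a) (factorizations n a) := by
  rintro p ⟨-, h0, hr, hs⟩
  rw [mem_coe, mem_factorizations]
  constructor
  · have := prod_ofFn_inv_mul (fun i => blockPerm (p i))
    rw [h0, hr, blockPerm_bot, blockPerm_top, inv_one, one_mul] at this
    exact this
  · intro i
    obtain ⟨B, hB, E, hEB, hEk, hρ⟩ := (splitsInto_iff (ha i)).1 (hs i)
    have hE : 2 ≤ E.card := hEk ▸ ha i
    rw [chainToFactors, hρ, incCycle_eq_of_cut hB hEB (card_pos.1 (by omega)),
      support_incCycle hE]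
    exact ⟨isCycle_incCycle hE, hEk⟩

theorem injOn_chainToFactors : Set.InjOn chainToFactors (chains n a) := by
  rintro p ⟨-, hp0, -, -⟩ q ⟨-, hq0, -, -⟩ h
  funext i
  induction i using Fin.induction with
  | zero => rw [hp0, hq0]
  | succ i ih =>
    have := congrFun h i
    rw [chainToFactors, chainToFactors, ih] at this
    exact blockPerm_injective (mul_left_cancel this)

theorem surjOn_chainToFactors (ha : ∀ i, 2 ≤ a i) (hn : ∑ i, (a i - 1) + 1 = n) :
    Set.SurjOn chainToFactors (chains n a) (factorizations n a) := by
  intro z hz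
  rw [mem_coe, mem_factorizations] at hz
  obtain ⟨hprod, hz⟩ := hz
  set v : ℕ → Equiv.Perm (Fin n) := fun i => ((List.ofFn z).take i).prod with hv
  have hv0 : v 0 = 1 := by simp [hv]
  have hvr : v r = finRotate n := by
    simp only [hv]
    rw [List.take_of_length_le (by simp), hprod]
  have hvs : ∀ i : Fin r, v (i + 1) = v i * z i := by
    intro i
    simp only [hv]
    rw [List.prod_take_succ _ _ (by simp)]
    simp
  have hvs' : ∀ i : Fin r, v i = v (i + 1) * (z i)⁻¹ := fun i => by
    rw [hvs, mul_inv_cancel_right]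
  have hstep : ∀ i : Fin r, fixedDim (v i) ≤ fixedDim (v (i + 1)) + (a i - 1) := by
    intro i
    rw [hvs' i, ← (hz i).2]
    exact fixedDim_mul_inv_le _ (hz i).1
  have htel : ∑ i : Fin r, ((fixedDim (v (i + 1)) : ℤ) - fixedDim (v i)) =
      fixedDim (v r) - fixedDim (v 0) := by
    rw [Fin.sum_univ_eq_sum_range (fun i => (fixedDim (v (i + 1)) : ℤ) - fixedDim (v i)),
      Finset.sum_range_sub (fun i => (fixedDim (v i) : ℤ))]
  -- The upper bounds `a i - 1` on the gains add up to `n - 1`, which is at most the total gain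
  -- between `v r` and `v 0`; so every bound is attained.
  have hmax : ∀ i : Fin r, fixedDim (v (i + 1)) + (a i - 1) = fixedDim (v i) := by
    have hnonneg : ∀ i ∈ (univ : Finset (Fin r)),
        0 ≤ (fixedDim (v (i + 1)) : ℤ) - fixedDim (v i) + ((a i - 1 : ℕ) : ℤ) := by
      intro i _
      have := hstep i
      omega
    have hsum : ∑ i : Fin r,
        ((fixedDim (v (i + 1)) : ℤ) - fixedDim (v i) + ((a i - 1 : ℕ) : ℤ)) ≤ 0 := by
      rw [sum_add_distrib, htel, hv0, hvr, fixedDim_one, ← Nat.cast_sum]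
      have := fixedDim_finRotate_le (n := n)
      omega
    have hzero := (sum_eq_zero_iff_of_nonneg hnonneg).1 (le_antisymm hsum (sum_nonneg hnonneg))
    intro i
    have := hzero i (mem_univ i)
    omega
  have hcut : ∀ i : Fin r, ∀ π : Finpartition (univ : Finset (Fin n)), blockPerm π = v (i + 1) →
      ∃ B ∈ π.parts, ∃ E ⊆ B, E.card = a i ∧ blockPerm (cut π B E) = v i := by
    intro i π hπ
    obtain ⟨B, hB, E, hEB, hEk, h⟩ := exists_cut_of_fixedDim_maximal π (hz i).1
      (by rw [hπ, ← hvs' i, (hz i).2, hmax i])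
    refine ⟨B, hB, E, hEB, hEk.trans (hz i).2, ?_⟩
    rw [hvs' i, ← hπ, ← h, mul_inv_cancel_right]
  have hex : ∀ i ≤ r, ∃ π : Finpartition (univ : Finset (Fin n)), blockPerm π = v i ∧
      IsNoncrossing π := by
    intro i hi
    induction hi using Nat.decreasingInduction with
    | self =>
      refine ⟨⊤, by rw [hvr, blockPerm_top], fun C hC D hD i hi j hj _ _ _ _ _ _ _ => ?_⟩
      rw [← Finpartition.part_eq_of_mem _ hC hi, ← Finpartition.part_eq_of_mem _ hD hj,
        part_top, part_top]
    | of_succ i hi ih =>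
      obtain ⟨π, hπ, hnc⟩ := ih
      obtain ⟨B, hB, E, hEB, hEk, h⟩ := hcut ⟨i, hi⟩ π hπ
      have := ha ⟨i, hi⟩
      exact ⟨cut π B E, h, isNoncrossing_cut hB (card_pos.1 (by omega)) hnc⟩
  choose p hp hnc using fun i : Fin (r + 1) => hex i (Nat.lt_succ_iff.1 i.2)
  refine ⟨p, ⟨hnc, ?_, ?_, fun i => ?_⟩, ?_⟩
  · refine blockPerm_injective ?_
    rw [hp, blockPerm_bot]
    exact hv0
  · refine blockPerm_injective ?_
    rw [hp, blockPerm_top]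
    exact hvr
  · obtain ⟨B, hB, E, hEB, hEk, h⟩ := hcut i (p i.succ) (hp i.succ)
    refine (splitsInto_iff (ha i)).2 ⟨B, hB, E, hEB, hEk, blockPerm_injective ?_⟩
    rw [h, hp]
    rfl
  · funext i
    rw [chainToFactors, hp, hp, Fin.val_castSucc, Fin.val_succ, hvs, inv_mul_cancel_left]

theorem bijOn_chainToFactors (ha : ∀ i, 2 ≤ a i) (hn : ∑ i, (a i - 1) + 1 = n) :
    Set.BijOn chainToFactors (chains n a) (factorizations n a) :=
  ⟨mapsTo_chainToFactors ha, injOn_chainToFactors, surjOn_chainToFactors ha hn⟩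

end Bijection

end MinFact
namespace MinFact

open Finset

/-! ### Weighted enumeration of chains. -/

namespace SetFun

variable {R : Type*} [CommRing R]

theorem mul_apply_sum {ι : Type*} (s : Finset ι) (c : ι → R) (g : ι → SetFun R) {f : SetFun R}
    (k : SetFun R) {S : Finset ℕ} (hf : ∀ T ⊆ S, f T = ∑ i ∈ s, c i * g i T) :
    (f * k) S = ∑ i ∈ s, c i * (g i * k) S := by
  simp only [mul_apply, mul_sum]
  rw [sum_comm]
  refine sum_congr rfl fun T hT => ?_
  rw [hf T (mem_powerset.1 hT), sum_mul]
  exact sum_congr rfl fun i _ => mul_assoc _ _ _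

theorem prod_apply_empty {ι : Type*} (s : Finset ι) (f : ι → SetFun R) :
    (∏ i ∈ s, f i) ∅ = ∏ i ∈ s, f i ∅ := by
  classical
  induction s using Finset.induction_on with
  | empty => simp [one_apply]
  | insert i s hi ih =>
    rw [prod_insert hi, prod_insert hi, ← ih, mul_apply]
    simp

end SetFun

section ChainSum

variable {n : ℕ} {R : Type*} [CommRing R]

open Classical in
/-- The chains of type `a 0, …, a (r - 1)` from the partition into singletons to `π`. -/
noncomputable def chainsTo (a : ℕ → ℕ) (r : ℕ) (π : Finpartition (univ : Finset (Fin n))) :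
    Finset (Fin (r + 1) → Finpartition (univ : Finset (Fin n))) :=
  univ.filter fun p => p 0 = ⊥ ∧ p (Fin.last r) = π ∧
    ∀ i : Fin r, SplitsInto (a i) (p i.castSucc) (p i.succ)

theorem mem_chainsTo {a : ℕ → ℕ} {r : ℕ} {π : Finpartition (univ : Finset (Fin n))}
    {p : Fin (r + 1) → Finpartition (univ : Finset (Fin n))} : p ∈ chainsTo a r π ↔
    p 0 = ⊥ ∧ p (Fin.last r) = π ∧ ∀ i : Fin r, SplitsInto (a i) (p i.castSucc) (p i.succ) := by
  classical
  unfold chainsTo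
  rw [mem_filter, and_iff_right (mem_univ p)]

open Classical in
/-- The weight of a single step of a chain. -/
noncomputable def stepWeight (y : R) (ρ π : Finpartition (univ : Finset (Fin n))) : R :=
  if IntervalSplit ρ π then 1 else y

theorem eq_bot_iff_card_eq_one {π : Finpartition (univ : Finset (Fin n))} :
    π = ⊥ ↔ ∀ B ∈ π.parts, B.card = 1 := by
  constructor
  · rintro rfl B hB
    obtain ⟨x, -, rfl⟩ := Finpartition.mem_bot_iff.1 hB
    exact card_singleton x
  · intro h
    have key : ∀ x, π.part x = {x} := fun x => by
      obtain ⟨t, ht⟩ := card_eq_one.1 (h _ (π.part_mem.2 (mem_univ x)))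
      have := π.mem_part (mem_univ x)
      rw [ht, mem_singleton] at this
      rw [ht, this]
    refine finpartition_ext_part fun x => ?_
    rw [key, Finpartition.part_eq_of_mem _ (Finpartition.mem_bot_iff.2 ⟨x, mem_univ x, rfl⟩)
      (mem_singleton_self x)]

open Classical in
theorem sum_chainsTo_succ (a : ℕ → ℕ) (r : ℕ) (π : Finpartition (univ : Finset (Fin n)))
    (y : ℕ → R) :
    ∑ p ∈ chainsTo a (r + 1) π,
        ∏ i : Fin (r + 1), stepWeight (y i) (p i.castSucc) (p i.succ) =
      ∑ ρ ∈ univ.filter (fun ρ => SplitsInto (a r) ρ π), stepWeight (y r) ρ π *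
        ∑ q ∈ chainsTo a r ρ, ∏ i : Fin r, stepWeight (y i) (q i.castSucc) (q i.succ) := by
  simp only [mul_sum]
  rw [sum_sigma']
  refine sum_bij' (fun p _ => ⟨p (Fin.last r).castSucc, Fin.init p⟩)
    (fun s _ => Fin.snoc (α := fun _ => Finpartition (univ : Finset (Fin n))) s.2 π) ?_ ?_ ?_ ?_ ?_
  · intro p hp
    obtain ⟨h0, hl, hs⟩ := mem_chainsTo.1 hp
    rw [mem_sigma, mem_filter, mem_chainsTo]
    refine ⟨⟨mem_univ _, ?_⟩, h0, rfl, fun i => ?_⟩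
    · have := hs (Fin.last r)
      rwa [Fin.succ_last, hl] at this
    · exact hs i.castSucc
  · rintro ⟨ρ, q⟩ hq
    rw [mem_sigma, mem_filter, mem_chainsTo] at hq
    obtain ⟨⟨-, hρ⟩, h0, hl, hs⟩ := hq
    rw [mem_chainsTo]
    refine ⟨?_, Fin.snoc_last _ _, fun i => ?_⟩
    · rw [← Fin.castSucc_zero, Fin.snoc_castSucc]
      exact h0
    · induction i using Fin.lastCases with
      | last =>
        rw [Fin.snoc_castSucc, Fin.succ_last, Fin.snoc_last]
        dsimp only at hl ⊢
        rw [hl]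
        exact hρ
      | cast i =>
        rw [Fin.snoc_castSucc, Fin.succ_castSucc, Fin.snoc_castSucc]
        exact hs i
  · intro p hp
    dsimp only
    rw [← (mem_chainsTo.1 hp).2.1]
    exact Fin.snoc_init_self p
  · rintro ⟨ρ, q⟩ hq
    rw [mem_sigma, mem_filter, mem_chainsTo] at hq
    dsimp only at hq ⊢
    rw [Fin.snoc_castSucc, Fin.init_snoc, hq.2.2.1]
  · intro p hp
    rw [Fin.prod_univ_castSucc, mul_comm, Fin.succ_last, (mem_chainsTo.1 hp).2.1]
    rfl

open Classical in
theorem sum_splitsInto {M : Type*} [AddCommMonoid M] {k : ℕ} (hk : 2 ≤ k)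
    (π : Finpartition (univ : Finset (Fin n)))
    (F : Finpartition (univ : Finset (Fin n)) → M) :
    ∑ ρ ∈ univ.filter (fun ρ => SplitsInto k ρ π), F ρ =
      ∑ B ∈ π.parts, ∑ E ∈ B.powersetCard k, F (cut π B E) := by
  rw [sum_sigma']
  symm
  refine sum_bij (fun s _ => cut π s.1 s.2) ?_ ?_ ?_ (fun _ _ => rfl)
  · rintro ⟨B, E⟩ h
    rw [mem_sigma, mem_powersetCard] at h
    exact mem_filter.2 ⟨mem_univ _, (splitsInto_iff hk).2 ⟨B, h.1, E, h.2.1, h.2.2, rfl⟩⟩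
  · rintro ⟨B, E⟩ h ⟨B', E'⟩ h' heq
    rw [mem_sigma, mem_powersetCard] at h h'
    obtain ⟨hB, hE, hEk⟩ := h
    obtain ⟨hB', hE', hEk'⟩ := h'
    dsimp only at hB hE hEk hB' hE' hEk' heq
    obtain ⟨rfl, rfl⟩ := cut_injective hB hE (by omega) hB' hE' (card_pos.1 (by omega)) heq
    rfl
  · intro ρ hρ
    obtain ⟨B, hB, E, hEB, hEk, rfl⟩ := (splitsInto_iff hk).1 (mem_filter.1 hρ).2
    exact ⟨⟨B, E⟩, mem_sigma.2 ⟨hB, mem_powersetCard.2 ⟨hEB, hEk⟩⟩, rfl⟩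

/-- Induction on the last step. The Leibniz rule for the product over the blocks selects the block
that this step cuts, `shift_blockWeight` expands its weight over the cut sets, and the result is the
product over the blocks of the cut partition. -/
theorem sum_chainsTo (a : ℕ → ℕ) (ha : ∀ i, 2 ≤ a i) (y : ℕ → R) (r : ℕ)
    (π : Finpartition (univ : Finset (Fin n))) :
    ∑ p ∈ chainsTo a r π, ∏ i : Fin r, stepWeight (y i) (p i.castSucc) (p i.succ) =
      (∏ B ∈ π.parts, blockWeight (fun i => a i - 1) y B.card) (range r) := by
  classical
  induction r generalizing π with
  | zero =>
    rw [range_zero, SetFun.prod_apply_empty]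
    -- At the empty step set a block has weight `1` if it is a singleton and `0` otherwise, so the
    -- product tests whether `π = ⊥`.
    simp only [univ_eq_empty, prod_empty, blockWeight_apply, sum_empty, zero_add]
    by_cases hπ : π = ⊥
    · have h1 : chainsTo a 0 π = {fun _ => π} := by
        ext p
        rw [mem_chainsTo, mem_singleton]
        constructor
        · rintro ⟨-, h, -⟩
          funext i
          rw [show i = Fin.last 0 from Fin.ext (by simp), h]
        · rintro rfl
          exact ⟨hπ, rfl, fun i => i.elim0⟩
      rw [h1, sum_singleton]
      refine (prod_eq_one fun B hB => ?_).symm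
      rw [if_pos (eq_bot_iff_card_eq_one.1 hπ B hB).symm]
      rfl
    · have h1 : chainsTo a 0 π = ∅ := by
        rw [eq_empty_iff_forall_notMem]
        intro p hp
        obtain ⟨h0, h, -⟩ := mem_chainsTo.1 hp
        exact hπ (h ▸ h0)
      rw [h1, sum_empty]
      obtain ⟨B, hB, hB1⟩ : ∃ B ∈ π.parts, B.card ≠ 1 := by
        by_contra h
        push Not at h
        exact hπ (eq_bot_iff_card_eq_one.2 h)
      exact (prod_eq_zero hB (if_neg hB1.symm)).symm
  | succ r ih =>
    rw [sum_chainsTo_succ, sum_splitsInto (ha r), range_add_one,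
      SetFun.prod_apply_insert _ _ notMem_range_self]
    refine sum_congr rfl fun B hB => ?_
    have hw : a r - 1 + 1 = a r := by have := ha r; omega
    rw [SetFun.mul_apply_sum (B.powersetCard (a r)) (fun E => if Dominates E B then 1 else y r)
      (fun E => ∏ e ∈ E, blockWeight (fun i => a i - 1) y (arc B E e).card) _ fun T hT => by
        have := shift_blockWeight (fun i => a i - 1) y B (i := r) (S := T)
          fun s hs => mem_range.1 (hT hs)
        rwa [hw] at this]
    refine sum_congr rfl fun E hE => ?_
    obtain ⟨hEB, hEk⟩ := mem_powersetCard.1 hE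
    have hE2 : 2 ≤ E.card := hEk ▸ ha r
    rw [ih, stepWeight, if_congr (intervalSplit_cut_iff hB hEB hE2) rfl rfl,
      parts_cut hB hEB (card_pos.1 (by omega)), prod_union (disjoint_erase_image_arc hB hEB),
      prod_image (arc_injOn hEB), mul_comm (∏ C ∈ π.parts.erase B, _)]

end ChainSum

/-! ### The product formula and the cardinality. -/

section Main

variable {n r : ℕ} {a : Fin r → ℕ}

/-- The extension of a tuple of lengths to a sequence. -/
def extendLengths (a : Fin r → ℕ) (i : ℕ) : ℕ := if h : i < r then a ⟨i, h⟩ else 2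

theorem extendLengths_val (a : Fin r → ℕ) (i : Fin r) : extendLengths a i = a i := dif_pos i.2

/-- Noncrossing is automatic: it holds for the one-block partition and passes down along cuts. -/
theorem mem_chains_iff (ha : ∀ i, 2 ≤ a i)
    (p : Fin (r + 1) → Finpartition (univ : Finset (Fin n))) :
    p ∈ chains n a ↔ p ∈ chainsTo (extendLengths a) r ⊤ := by
  rw [mem_chainsTo]
  simp only [extendLengths_val]
  refine ⟨fun h => h.2, fun h => ⟨fun i => ?_, h⟩⟩
  induction i using Fin.reverseInduction with
  | last =>
    rw [h.2.1]
    intro C hC D hD i hi j hj _ _ _ _ _ _ _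
    rw [← Finpartition.part_eq_of_mem _ hC hi, ← Finpartition.part_eq_of_mem _ hD hj,
      part_top, part_top]
  | cast i ih =>
    obtain ⟨B, hB, E, hEB, hEk, hρ⟩ := (splitsInto_iff (ha i)).1 (h.2.2 i)
    rw [hρ]
    have := ha i
    exact isNoncrossing_cut hB (card_pos.1 (by omega)) ih

/-- The variables of the weights, with the value `1` at the index `0`. -/
noncomputable def stepVariable (i : ℕ) : MvPolynomial ℕ ℤ :=
  if i = 0 then 1 else MvPolynomial.X i

theorem chainWeight_eq (p : Fin (r + 1) → Finpartition (univ : Finset (Fin n))) :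
    chainWeight p = ∏ i : Fin r, stepWeight (stepVariable i) (p i.castSucc) (p i.succ) := by
  classical
  unfold chainWeight stepWeight stepVariable
  rw [prod_filter]
  refine prod_congr rfl fun i _ => ?_
  by_cases h0 : i.val = 0 <;> by_cases h1 : IntervalSplit (p i.castSucc) (p i.succ) <;>
    simp [h0, h1, Nat.one_le_iff_ne_zero]

theorem sum_extendLengths (a : Fin r → ℕ) :
    ∑ t ∈ range r, (extendLengths a t - 1) = ∑ i, (a i - 1) := by
  rw [← Fin.sum_univ_eq_sum_range (fun t => extendLengths a t - 1)]
  simp only [extendLengths_val]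

theorem sum_filter_extendLengths (a : Fin r → ℕ) (s : ℕ) :
    ∑ t ∈ (range r).filter (· < s), (extendLengths a t - 1) = partialSum a s := by
  rw [partialSum, sum_filter, sum_filter,
    ← Fin.sum_univ_eq_sum_range (fun t => if t < s then extendLengths a t - 1 else 0)]
  simp only [extendLengths_val]

theorem sum_weight (ha : ∀ i, 2 ≤ a i) (hn : ∑ i, (a i - 1) + 1 = n) :
    ∑ z ∈ factorizations n a, weight a z = ∏ i ∈ Icc 1 (r - 1),
      ((partialSum a i : MvPolynomial ℕ ℤ) * MvPolynomial.X i +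
        ((n : MvPolynomial ℕ ℤ) - (partialSum a i : MvPolynomial ℕ ℤ))) := by
  have hcoe : ((chainsTo (extendLengths a) r ⊤ :
      Finset (Fin (r + 1) → Finpartition (univ : Finset (Fin n)))) : Set _) = chains n a := by
    ext p
    rw [mem_coe, mem_chains_iff ha]
  have hbij := bijOn_chainToFactors ha hn
  have h1 : ∑ p ∈ chainsTo (extendLengths a) r (⊤ : Finpartition (univ : Finset (Fin n))),
      chainWeight p = ∑ z ∈ factorizations n a, weight a z := by
    refine sum_nbij chainToFactors (fun p hp => ?_) ?_ ?_ fun p hp => ?_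
    · exact mem_coe.1 (hbij.mapsTo ((mem_chains_iff ha p).2 hp))
    · rw [hcoe]; exact hbij.injOn
    · rw [hcoe]; exact hbij.surjOn
    · rw [weight, hbij.injOn.leftInvOn_invFunOn ((mem_chains_iff ha p).2 hp)]
  -- The default length `2` outside the tuple keeps this bound valid for all indices.
  have ha' : ∀ i, 2 ≤ extendLengths a i := fun i => by
    unfold extendLengths
    split_ifs with h
    · exact ha _
    · exact le_rfl
  have hparts : (⊤ : Finpartition (univ : Finset (Fin n))).parts = {univ} := by
    refine subset_antisymm (Finpartition.parts_top_subset _) (singleton_subset_iff.2 ?_)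
    have h := (⊤ : Finpartition (univ : Finset (Fin n))).part_mem.2
      (mem_univ (⟨0, by omega⟩ : Fin n))
    rwa [part_top] at h
  have hfilter : (range r).filter (fun s => ∃ t ∈ range r, t < s) = Icc 1 (r - 1) := by
    ext s
    simp only [mem_filter, mem_range, mem_Icc]
    constructor
    · rintro ⟨h1, t, -, h2⟩
      omega
    · rintro ⟨h1, h2⟩
      exact ⟨by omega, 0, by omega, by omega⟩
  have hhur : hurwitz (fun i => extendLengths a i - 1) stepVariable 1 (range r) =
      reducedHurwitz (fun i => extendLengths a i - 1) stepVariable 1 (range r) := by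
    rcases Nat.eq_zero_or_pos r with rfl | hr
    · simp [hurwitz, reducedHurwitz]
    · rw [hurwitz, if_neg (nonempty_range_iff.2 hr.ne').ne_empty, one_mul]
  rw [← h1, sum_congr rfl fun p _ => chainWeight_eq p,
    sum_chainsTo (extendLengths a) ha' stepVariable, hparts, prod_singleton, blockWeight_apply,
    sum_extendLengths, card_univ, Fintype.card_fin, if_pos hn, hhur, reducedHurwitz, hfilter]
  -- With `b = partialSum a i`, the factor `1 + (n - 1) + b * (X_i - 1)` is `b * X_i + (n - b)`.
  refine prod_congr rfl fun i hi => ?_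
  rw [sum_extendLengths, sum_filter_extendLengths, stepVariable,
    if_neg (by have := mem_Icc.1 hi; omega), ← hn]
  push_cast
  ring

theorem card_factorizations (ha : ∀ i, 2 ≤ a i) (hn : ∑ i, (a i - 1) + 1 = n) :
    (factorizations n a).card = n ^ (r - 1) := by
  have h := congrArg (MvPolynomial.eval (fun _ => (1 : ℤ))) (sum_weight ha hn)
  have hw : ∀ z : Fin r → Equiv.Perm (Fin n),
      MvPolynomial.eval (fun _ => (1 : ℤ)) (weight a z) = 1 := by
    intro z
    simp [weight, chainWeight]
  rw [map_sum, sum_congr rfl fun z _ => hw z, map_prod] at h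
  simp only [map_add, map_mul, map_sub, map_natCast, MvPolynomial.eval_X, mul_one,
    add_sub_cancel, prod_const, sum_const, nsmul_eq_mul, Nat.card_Icc, Nat.add_sub_cancel] at h
  exact_mod_cast h

end Main

end MinFact

theorem theorem1 (n r : ℕ) (a : Fin r → ℕ) (ha : ∀ i, 2 ≤ a i)
    (hn : ∑ i, (a i - 1) + 1 = n) :
    Set.BijOn MinFact.chainToFactors (MinFact.chains n a) (MinFact.factorizations n a) ∧
    ∑ z ∈ MinFact.factorizations n a, MinFact.weight a z =
      ∏ i ∈ Finset.Icc 1 (r - 1),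
        ((MinFact.partialSum a i : MvPolynomial ℕ ℤ) * MvPolynomial.X i +
          ((n : MvPolynomial ℕ ℤ) - (MinFact.partialSum a i : MvPolynomial ℕ ℤ))) ∧
    (MinFact.factorizations n a).card = n ^ (r - 1) :=
  ⟨MinFact.bijOn_chainToFactors ha hn, MinFact.sum_weight ha hn,
    MinFact.card_factorizations ha hn⟩
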